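/- For $d>0$ let $I_d=(-\frac d2,\frac d2)$. Let $\mathcal A(I_\pi)$ be the class of increasing functions $\psi:I_\pi\to[-\infty,+\infty]$ such that, with $\mathrm{dom}(\psi)=\{x\in I_\pi:\ \psi(x)\in\mathbb R\}$, $$\psi(y)-\psi(x)\ \ge\ 2\tan\Big(\frac{y-x}{2}\Big)\qquad\text{for all } x<y \text{ in } \mathrm{dom}(\psi).$$ For $\psi\in\mathcal A(I_\pi)$ finite on $I_d$, let $q=\psi'+\psi^2$ be the nonnegative Borel measure on $I_d$ which is the sum of the distributional derivative $\psi'$ of $\psi$ and of $\psi^2\,dx$. For a nonnegative Borel measure $q$ on $I_d$ set $$\lambda_1(I_d,q)=\inf\Big\{\frac{\int_{I_d}|v'|^2\,dx+\int_{I_d}|v|^2\,dq}{\int_{I_d}|v|^2\,dx}\ :\ v\in H^1_0(I_d)\cap L^2(I_d,q),\ v\neq0\Big\}.$$ **Theorem.** (i) There exists an absolute constant $C>0$ such that, for every $0<d\le\pi$ and every $\psi\in\mathcal A(I_\pi)$ with $\mathrm{dom}(\psi)=I_d$, $$\lambda_1(I_d,\psi'+\psi^2)\ \ge\ 3+C(\pi-d)^3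 .$$ (ii) There exists an absolute constant $K>0$ such that the following holds. Let $d\le\pi$, $m>0$, let $f\in\mathcal A(I_\pi)$ with $\mathrm{dom}(f)=I_d$, let $h:I_d\to(0,+\infty)$ be $\frac1m$-concave (that is, $h^{1/m}$ is concave on $I_d$) and affine on an interval $[a,b]$ with $I_{\pi/4}\subseteq[a,b]\subseteq I_d$, and let $\psi\in\mathcal A(I_\pi)$ be of the form $\psi=f+\frac g2$ on $I_d$, where $g=-(\log h)'$ (equality almost everywhere, since $g$ is defined almost everywhere). Then $$\lambda_1(I_d,\psi'+\psi^2)\le 7\ \Longrightarrow\ \lambda_1(I_d,\psi'+\psi^2)\ \ge\ 3+\frac{8K}{m\pi^2}\Big[1-\frac{\min\{h(a),h(b)\}}{\max\{h(a),h(b)\}}\Big]^2 .$$ -/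

import Mathlib

open Set MeasureTheory Filter
open scoped ENNReal

noncomputable section

namespace SpectralGap

/-- The centred open interval `I_d = (-d/2, d/2)`. -/
def centred (d : ℝ) : Set ℝ := Ioo (-(d / 2)) (d / 2)

/-- The finiteness domain, inside `I_π`, of an extended real valued function. -/
def dom (ψ : ℝ → EReal) : Set ℝ := {x | x ∈ centred Real.pi ∧ ψ x ≠ ⊥ ∧ ψ x ≠ ⊤}

/-- The class `𝒜(I_π)`: increasing extended real valued functions on `I_π` such that
`ψ y - ψ x ≥ 2 tan ((y - x) / 2)` whenever `x < y` belong to `dom ψ`.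
(Values outside `I_π` play no role.) -/
structure Admissible (ψ : ℝ → EReal) : Prop where
  mono : MonotoneOn ψ (centred Real.pi)
  modulus : ∀ x ∈ dom ψ, ∀ y ∈ dom ψ, x < y →
    2 * Real.tan ((y - x) / 2) ≤ (ψ y).toReal - (ψ x).toReal

/-- `F` frozen outside `[a, b]`. -/
def clamp (F : ℝ → ℝ) (a b : ℝ) (x : ℝ) : ℝ := F (max a (min x b))

theorem clamp_monotone {F : ℝ → ℝ} {a b : ℝ} (hab : a ≤ b) (hF : MonotoneOn F (Icc a b)) :
    Monotone (clamp F a b) := by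
  intro x y hxy
  refine hF ⟨le_max_left _ _, max_le hab (min_le_right _ _)⟩
    ⟨le_max_left _ _, max_le hab (min_le_right _ _)⟩ ?_
  exact max_le_max le_rfl (min_le_min hxy le_rfl)

open Classical in
/-- The Lebesgue-Stieltjes measure on `(a, b)` of a function which is nondecreasing on `[a, b]`
(zero if `F` is not nondecreasing there). -/
def stieltjesOn (F : ℝ → ℝ) (a b : ℝ) : Measure ℝ :=
  if h : a ≤ b ∧ MonotoneOn F (Icc a b) then
    ((clamp_monotone h.1 h.2).stieltjesFunction.measure).restrict (Ioo a b)
  else 0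

theorem clamp_of_mem {F : ℝ → ℝ} {a b x : ℝ} (hx : x ∈ Icc a b) : clamp F a b x = F x := by
  simp [clamp, hx.1, hx.2]

theorem clamp_rightLim {F : ℝ → ℝ} {a b x : ℝ} (hF : MonotoneOn F (Icc a b))
    (hx : x ∈ Ico a b) :
    Function.rightLim (clamp F a b) x = Function.rightLim F x := by
  have hm := clamp_monotone (hx.1.trans hx.2.le) hF
  refine (rightLim_eq_of_tendsto ?_).symm
  refine (hm.tendsto_rightLim x).congr' ?_
  filter_upwards [Ioo_mem_nhdsGT hx.2] with y hy
  exact clamp_of_mem ⟨hx.1.trans hy.1.le, hy.2.le⟩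

theorem clamp_leftLim {F : ℝ → ℝ} {a b x : ℝ} (hF : MonotoneOn F (Icc a b))
    (hx : x ∈ Ioc a b) :
    Function.leftLim (clamp F a b) x = Function.leftLim F x := by
  have hm := clamp_monotone (hx.1.le.trans hx.2) hF
  refine (leftLim_eq_of_tendsto ?_).symm
  refine (hm.tendsto_leftLim x).congr' ?_
  filter_upwards [Ioo_mem_nhdsLT hx.1] with y hy
  exact clamp_of_mem ⟨hy.1.le, hy.2.le.trans hx.2⟩

theorem leftLim_rightLim_clamp {F : ℝ → ℝ} {a b x : ℝ} (hF : MonotoneOn F (Icc a b))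
    (hx : x ∈ Ioc a b) :
    Function.leftLim (Function.rightLim (clamp F a b)) x = Function.leftLim F x := by
  have hm := clamp_monotone (hx.1.le.trans hx.2) hF
  rw [leftLim_rightLim (hm.tendsto_leftLim x), clamp_leftLim hF hx]

theorem stieltjesOn_Ioc {F : ℝ → ℝ} {a b x y : ℝ} (hF : MonotoneOn F (Icc a b))
    (hax : a ≤ x) (hxy : x ≤ y) (hyb : y < b) :
    stieltjesOn F a b (Ioc x y) =
      ENNReal.ofReal (Function.rightLim F y - Function.rightLim F x) := by
  rw [stieltjesOn, dif_pos ⟨hax.trans (hxy.trans hyb.le), hF⟩,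
    Measure.restrict_apply measurableSet_Ioc,
    inter_eq_left.2 (show Ioc x y ⊆ Ioo a b from
      fun z hz => ⟨hax.trans_lt hz.1, hz.2.trans_lt hyb⟩),
    StieltjesFunction.measure_Ioc, Monotone.stieltjesFunction_eq, Monotone.stieltjesFunction_eq,
    clamp_rightLim hF ⟨hax, hxy.trans_lt hyb⟩, clamp_rightLim hF ⟨hax.trans hxy, hyb⟩]

theorem stieltjesOn_restrict {F : ℝ → ℝ} {a b a' b' : ℝ} (hab : a ≤ b) (ha : a' ≤ a)
    (hb : b ≤ b') (hF : MonotoneOn F (Icc a' b')) :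
    stieltjesOn F a b = (stieltjesOn F a' b').restrict (Ioo a b) := by
  have hF' : MonotoneOn F (Icc a b) := hF.mono (Icc_subset_Icc ha hb)
  rw [stieltjesOn, stieltjesOn, dif_pos ⟨hab, hF'⟩, dif_pos ⟨ha.trans (hab.trans hb), hF⟩,
    Measure.restrict_restrict measurableSet_Ioo, inter_eq_left.2 (Ioo_subset_Ioo ha hb)]
  refine Measure.ext_of_Ioc _ _ fun u v huv => ?_
  rw [Measure.restrict_apply measurableSet_Ioc, Measure.restrict_apply measurableSet_Ioc]
  rcases lt_or_ge v b with hv | hv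
  · have : Ioc u v ∩ Ioo a b = Ioc (max u a) v := by
      ext z; simp only [mem_inter_iff, mem_Ioc, mem_Ioo, max_lt_iff]; grind
    rw [this]
    rcases lt_or_ge v (max u a) with h | h
    · simp [Ioc_eq_empty_of_le h.le]
    · have h1 : a ≤ max u a := le_max_right _ _
      simp only [StieltjesFunction.measure_Ioc, Monotone.stieltjesFunction_eq]
      rw [clamp_rightLim hF' ⟨h1, h.trans_lt hv⟩, clamp_rightLim hF' ⟨h1.trans h, hv⟩,
        clamp_rightLim hF ⟨ha.trans h1, (h.trans_lt hv).trans_le hb⟩,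
        clamp_rightLim hF ⟨ha.trans (h1.trans h), hv.trans_le hb⟩]
  · have : Ioc u v ∩ Ioo a b = Ioo (max u a) b := by
      ext z; simp only [mem_inter_iff, mem_Ioc, mem_Ioo, max_lt_iff]; grind
    rw [this]
    rcases le_or_gt b (max u a) with h | h
    · simp [Ioo_eq_empty_of_le h]
    · have h1 : a ≤ max u a := le_max_right _ _
      have e1 : ((clamp_monotone hab hF').stieltjesFunction : ℝ → ℝ) =
        Function.rightLim (clamp F a b) := rfl
      have e2 : ((clamp_monotone (ha.trans (hab.trans hb)) hF).stieltjesFunction : ℝ → ℝ) =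
        Function.rightLim (clamp F a' b') := rfl
      rw [StieltjesFunction.measure_Ioo, StieltjesFunction.measure_Ioo, e1, e2,
        clamp_rightLim hF' ⟨h1, h⟩, clamp_rightLim hF ⟨ha.trans h1, h.trans_le hb⟩,
        leftLim_rightLim_clamp hF' ⟨h1.trans_lt h, le_rfl⟩,
        leftLim_rightLim_clamp hF ⟨(ha.trans h1).trans_lt h, hb⟩]

/-- The distributional derivative `F'` of a nondecreasing function `F` on the open interval
`(α, β)`, as a nonnegative Borel measure: the increasing limit of the Lebesgue-Stieltjes measures
of `F` on intervals exhausting `(α, β)`. It is possibly infinite near the endpoints, and carries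
no mass outside `(α, β)`. See `derivMeasure_Ioc` and `derivMeasure_compl`. -/
def derivMeasure (F : ℝ → ℝ) (α β : ℝ) : Measure ℝ :=
  ⨆ n : ℕ, stieltjesOn F (α + (β - α) / (n + 3)) (β - (β - α) / (n + 3))

theorem derivMeasure_compl (F : ℝ → ℝ) (α β : ℝ) : derivMeasure F α β (Ioo α β)ᶜ = 0 := by
  have key : derivMeasure F α β ≤ (⊤ : Measure ℝ).restrict (Ioo α β) := by
    refine iSup_le fun n => ?_
    rw [stieltjesOn]
    split_ifs with h
    · refine Measure.restrict_mono ?_ le_top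
      have h1 : 0 ≤ (β - α) / ((n : ℝ) + 3) := by
        have h3 : (0 : ℝ) < (n : ℝ) + 3 := by positivity
        by_contra hc
        have h4 : β - α < 0 := by
          by_contra h5
          exact hc (div_nonneg (not_lt.1 h5) h3.le)
        have h6 : (β - α) / ((n : ℝ) + 3) * ((n : ℝ) + 3) = β - α := by field_simp
        have h7 : (0 : ℝ) ≤ n := by positivity
        nlinarith [h.1]
      exact Ioo_subset_Ioo (by linarith) (by linarith)
    · exact bot_le
  refine le_antisymm ((key _).trans ?_) bot_le
  rw [Measure.restrict_apply measurableSet_Ioo.compl]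
  simp

theorem derivMeasure_Ioc {F : ℝ → ℝ} {α β x y : ℝ} (hF : MonotoneOn F (Ioo α β))
    (hx : α < x) (hxy : x ≤ y) (hy : y < β) :
    derivMeasure F α β (Ioc x y) =
      ENNReal.ofReal (Function.rightLim F y - Function.rightLim F x) := by
  have hαβ : 0 < β - α := by linarith
  set e : ℕ → ℝ := fun n => (β - α) / (n + 3) with he
  have hpos : ∀ n, 0 < e n := fun n => by positivity
  have hanti : Antitone e := fun n k hnk => by
    simp only [he]
    gcongr
  have hsmall : ∀ n, e n ≤ (β - α) / 3 := fun n => by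
    simp only [he]
    gcongr
    linarith [(Nat.cast_nonneg n : (0 : ℝ) ≤ n)]
  have hlim : Tendsto e atTop (nhds 0) :=
    tendsto_const_nhds.div_atTop
      (tendsto_atTop_add_const_right _ _ tendsto_natCast_atTop_atTop)
  have hmono : ∀ n, MonotoneOn F (Icc (α + e n) (β - e n)) := fun n =>
    hF.mono fun z hz => ⟨by linarith [hz.1, hpos n], by linarith [hz.2, hpos n]⟩
  obtain ⟨N, hN⟩ : ∃ N, e N < min (x - α) (β - y) :=
    (hlim.eventually (gt_mem_nhds (lt_min (by linarith) (by linarith)))).exists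
  have hN1 := hN.trans_le (min_le_left _ _)
  have hN2 := hN.trans_le (min_le_right _ _)
  set G : ℕ → Measure ℝ := fun n => stieltjesOn F (α + e n) (β - e n) with hG
  have hGN : G N (Ioc x y) = ENNReal.ofReal (Function.rightLim F y - Function.rightLim F x) :=
    stieltjesOn_Ioc (hmono N) (by linarith) hxy (by linarith)
  have hres : ∀ n k, n ≤ k → G n = (G k).restrict (Ioo (α + e n) (β - e n)) := fun n k hnk =>
    stieltjesOn_restrict (by linarith [hsmall n]) (by linarith [hanti hnk])
      (by linarith [hanti hnk]) (hmono k)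
  have hS : Ioc x y ⊆ Ioo (α + e N) (β - e N) := fun z hz =>
    ⟨by linarith [hz.1], by linarith [hz.2]⟩
  have key : derivMeasure F α β ≤
      (G N).restrict (Ioc x y) + (⊤ : Measure ℝ).restrict (Ioc x y)ᶜ := by
    refine iSup_le fun n => ?_
    have h1 : G n ≤ G (max n N) := by
      rw [hres n _ (le_max_left n N)]
      exact Measure.restrict_le_self
    have h2 : (G N).restrict (Ioc x y) = (G (max n N)).restrict (Ioc x y) := by
      rw [hres N _ (le_max_right n N), Measure.restrict_restrict measurableSet_Ioc,
        inter_eq_left.2 hS]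
    refine h1.trans ?_
    rw [h2]
    nth_rewrite 1 [← Measure.restrict_add_restrict_compl (μ := G (max n N))
      (measurableSet_Ioc (a := x) (b := y))]
    exact add_le_add le_rfl (Measure.restrict_mono subset_rfl le_top)
  refine le_antisymm ((key _).trans ?_) ?_
  · rw [Measure.add_apply, Measure.restrict_apply measurableSet_Ioc,
      Measure.restrict_apply measurableSet_Ioc, inter_self, inter_compl_self, measure_empty,
      add_zero, hGN]
  · rw [← hGN]
    exact (le_iSup G N) _

/-- The measure `ψ' + ψ ^ 2` (that is, `ψ' + ψ ^ 2 dx`) on the open interval `(α, β)`. -/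
def potential (ψ : ℝ → EReal) (α β : ℝ) : Measure ℝ :=
  derivMeasure (fun x => (ψ x).toReal) α β +
    (volume.restrict (Ioo α β)).withDensity (fun x => ENNReal.ofReal ((ψ x).toReal ^ 2))

/-- The Sobolev space `H¹₀(α, β)` on a bounded open interval, through continuous representatives:
absolutely continuous functions on `[α, β]` which vanish at the endpoints and whose derivative
is in `L²(α, β)`. -/
structure MemH10 (α β : ℝ) (v : ℝ → ℝ) : Prop where
  absCont : AbsolutelyContinuousOnInterval v α β
  left : v α = 0
  right : v β = 0
  deriv_memLp : MemLp (deriv v) 2 (volume.restrict (Ioo α β))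

/-- The Rayleigh quotient of `v` on `(α, β)` with potential the measure `q`. -/
def rayleigh (α β : ℝ) (q : Measure ℝ) (v : ℝ → ℝ) : ℝ≥0∞ :=
  ((∫⁻ x in Ioo α β, ENNReal.ofReal (deriv v x ^ 2)) +
      ∫⁻ x in Ioo α β, ENNReal.ofReal (v x ^ 2) ∂q) /
    ∫⁻ x in Ioo α β, ENNReal.ofReal (v x ^ 2)

/-- The first Dirichlet eigenvalue `λ₁((α, β), q)` with potential the nonnegative Borel measure
`q`: the infimum of the Rayleigh quotient over the nonzero functions in
`H¹₀(α, β) ∩ L²((α, β), q)`. -/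
def lambda1 (α β : ℝ) (q : Measure ℝ) : ℝ≥0∞ :=
  ⨅ v ∈ {v : ℝ → ℝ | MemH10 α β v ∧ MemLp v 2 (q.restrict (Ioo α β)) ∧
    ∃ x ∈ Ioo α β, v x ≠ 0}, rayleigh α β q v

/-- `λ₁(I_d, ψ' + ψ ^ 2)`. -/
def gapEigenvalue (d : ℝ) (ψ : ℝ → EReal) : ℝ≥0∞ :=
  lambda1 (-(d / 2)) (d / 2) (potential ψ (-(d / 2)) (d / 2))

end SpectralGap

end

namespace SpectralGap

open scoped Topology

/-! Write p for ψ. If z vanishes near the ends of I_d, integrating z² against ψ' by parts turns its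
energy into ∫ (z' - p z)². The eigenvalue bound is therefore the Hardy type inequality λ ∫ z² ≤ ∫
(z' - p z)², passed to all test functions by soft thresholding and Fatou.

Completing the square, the inequality holds once the Riccati equation η' = -λ - η² - 2 p η has a
solution on the support of z. One solution is η = -λ w / w', where w'' = 2 p w' - λ w and w' > 0.
Start w with w' = 0 at -A, to the left of the support. If w' vanished again at b, then w would solve
a Neumann problem on [-A, b], and a comparison of moduli of continuity in the style of Andrews and
Clutterbuck rules this out (`false_of_two_point`). It needs an increasing profile Φ with Φ(0) = 0
and, at s = (y - x)/2, Φ'' - (p(y) - p(x)) Φ' + λ Φ ≤ -γ < 0. Everything thus reduces to choosing Φ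
(`ofReal_le_gapEigenvalue_of_profile`).

The model is Φ = sin, for which Φ'' - 2 tan Φ' + 3 Φ = 0; this is the constant 3. In (i) the gain
comes from subtracting a multiple of tan, which is bounded when s stays below d/2 < π/2.

In (ii), -(log h)' is nondecreasing, and where h is affine with slope s it grows at rate s²/h².
Every interval in I_π longer than 6/5 meets I_{π/4} in a definite length, so the increments of ψ
exceed 2 tan by some δ > 0 on long intervals. A quintic perturbation of the profile in sin s
converts this into a gain δ/500. The factor 1/m costs nothing, since a nonconstant affine h forces m
≥ 1. -/

/-! ### Prüfer coordinates and the shooting solution -/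

/-- The integrating factor `exp (∫ 2 p)`. -/
noncomputable def expInt (p : ℝ → ℝ) (x : ℝ) : ℝ := Real.exp (∫ t in (0 : ℝ)..x, 2 * p t)

theorem expInt_pos (p : ℝ → ℝ) (x : ℝ) : 0 < expInt p x := Real.exp_pos _

theorem intervalIntegrable_two_mul {p : ℝ → ℝ} (hp : Monotone p) (a b : ℝ) :
    IntervalIntegrable (fun t => 2 * p t) volume a b :=
  (hp.intervalIntegrable).const_mul 2

theorem continuous_expInt {p : ℝ → ℝ} (hp : Monotone p) : Continuous (expInt p) :=
  Real.continuous_exp.comp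
    (intervalIntegral.continuous_primitive (fun a b => intervalIntegrable_two_mul hp a b) 0)

theorem hasDerivAt_expInt {p : ℝ → ℝ} (hp : Monotone p) {x : ℝ} (hx : ContinuousAt p x) :
    HasDerivAt (expInt p) (2 * p x * expInt p x) x := by
  have h := intervalIntegral.integral_hasDerivAt_right (intervalIntegrable_two_mul hp 0 x)
    (hp.measurable.const_mul 2).stronglyMeasurable.stronglyMeasurableAtFilter (hx.const_mul 2)
  have h2 : HasDerivAt (expInt p) _ x := h.exp
  exact h2.congr_deriv (mul_comm _ _)

/-- The Prüfer angle equation of `w'' = 2 p w' - lam w`. -/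
theorem exists_prufer_angle {E : ℝ → ℝ} (hE : Continuous E) (hpos : ∀ x, 0 < E x) (lam : ℝ)
    {a b : ℝ} (hab : a < b) :
    ∃ θ : ℝ → ℝ, θ a = 0 ∧ ∀ t ∈ Ioo (a - 1) (b + 1),
      HasDerivAt θ (lam / E t * Real.cos (θ t) ^ 2 + E t * Real.sin (θ t) ^ 2) t := by
  have hc1 : Continuous fun t => |lam / E t| + |E t| :=
    ((continuous_const.div hE fun x => (hpos x).ne').abs).add hE.abs
  obtain ⟨B, hB⟩ := (isCompact_Icc (a := a - 1) (b := b + 1)).exists_bound_of_continuousOn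
    hc1.continuousOn
  have hB' : ∀ t ∈ Icc (a - 1) (b + 1), |lam / E t| + |E t| ≤ max B 0 := fun t ht =>
    ((le_abs_self _).trans (hB t ht)).trans (le_max_left _ _)
  set L : NNReal := (max B 0).toNNReal
  have hL : (L : ℝ) = max B 0 := Real.coe_toNNReal _ (le_max_right _ _)
  set T : NNReal := (b - a + 1).toNNReal
  have hT : (T : ℝ) = b - a + 1 := Real.coe_toNNReal _ (by linarith)
  have hsq : ∀ x : ℝ, |Real.cos x ^ 2| ≤ 1 ∧ |Real.sin x ^ 2| ≤ 1 := fun x => by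
    constructor <;> rw [abs_of_nonneg (sq_nonneg _)]
    · exact Real.cos_sq_le_one x
    · exact Real.sin_sq_le_one x
  -- The right-hand side is bounded by L for every value of θ, so a ball of radius L * T is never
  -- left and the solution lives on the whole interval. The margin of 1 on each side makes the
  -- derivatives at a and b two-sided.
  have hPL : IsPicardLindelof
      (fun t θ : ℝ => lam / E t * Real.cos θ ^ 2 + E t * Real.sin θ ^ 2)
      (tmin := a - 1) (tmax := b + 1) ⟨a, by constructor <;> linarith⟩ 0 (L * T) 0 L (2 * L) := by
    refine ⟨fun t ht => LipschitzWith.lipschitzOnWith ?_, fun x _ => ?_, fun t ht x _ => ?_, ?_⟩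
    · refine lipschitzWith_of_nnnorm_deriv_le (by fun_prop) fun x => ?_
      have : deriv (fun θ : ℝ => lam / E t * Real.cos θ ^ 2 + E t * Real.sin θ ^ 2) x =
          (E t - lam / E t) * Real.sin (2 * x) := by
        have h1 := ((Real.hasDerivAt_cos x).pow 2).const_mul (lam / E t)
        have h2 := ((Real.hasDerivAt_sin x).pow 2).const_mul (E t)
        have h3 : HasDerivAt (fun θ : ℝ => lam / E t * Real.cos θ ^ 2 + E t * Real.sin θ ^ 2) _ x :=
          h1.add h2
        rw [h3.deriv, Real.sin_two_mul]
        push_cast; ring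
      rw [this, ← NNReal.coe_le_coe, coe_nnnorm, NNReal.coe_mul, hL, Real.norm_eq_abs, abs_mul]
      have h1 := hB' t ht
      have h2 : |E t - lam / E t| ≤ max B 0 := by
        have := abs_sub (E t) (lam / E t); linarith
      have h3 := Real.abs_sin_le_one (2 * x)
      calc _ ≤ max B 0 * 1 := by gcongr
        _ ≤ _ := by
          have := le_max_right B 0
          push_cast; linarith
    · exact (((continuous_const.div hE fun x => (hpos x).ne').mul continuous_const).add
        (hE.mul continuous_const)).continuousOn
    · rw [hL, Real.norm_eq_abs]
      refine le_trans ?_ (hB' t ht)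
      refine (abs_add_le _ _).trans ?_
      rw [abs_mul, abs_mul]
      have := hsq x
      gcongr
      · exact mul_le_of_le_one_right (abs_nonneg _) this.1
      · exact mul_le_of_le_one_right (abs_nonneg _) this.2
    · have h0 : (0 : ℝ) ≤ b - a + 1 := by linarith
      simp only [NNReal.coe_mul, NNReal.coe_zero, sub_zero, hT]
      gcongr
      exact max_le (by linarith) (by linarith)
  obtain ⟨θ, h0, hθ⟩ := hPL.exists_eq_forall_mem_Icc_hasDerivWithinAt₀
  exact ⟨θ, h0, fun t ht => (hθ t ⟨ht.1.le, ht.2.le⟩).hasDerivAt (Icc_mem_nhds ht.1 ht.2)⟩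

/-- Solution of `w'' = 2 p w' - lam w` with `w' a = 0`, in Prüfer coordinates, `U = w'`. -/
theorem exists_shooting {p : ℝ → ℝ} (hp : Monotone p) {lam : ℝ} (hlam : 0 < lam) {a b : ℝ}
    (hab : a < b) :
    ∃ θ w U R : ℝ → ℝ, θ a = 0 ∧ StrictMonoOn θ (Icc a b) ∧
      (∀ t ∈ Icc a b, HasDerivAt θ (lam / expInt p t * Real.cos (θ t) ^ 2 +
        expInt p t * Real.sin (θ t) ^ 2) t) ∧
      (∀ t ∈ Icc a b, HasDerivAt w (U t) t) ∧
      (∀ t ∈ Icc a b, ContinuousAt U t) ∧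
      (∀ t, 0 < R t ∧ U t = R t * Real.sin (θ t)) ∧
      (∀ t ∈ Icc a b, ContinuousAt p t → HasDerivAt U (2 * p t * U t - lam * w t) t) := by
  have hEc := continuous_expInt hp
  have hE := expInt_pos p
  obtain ⟨θ, h0, hθ⟩ := exists_prufer_angle hEc hE lam hab
  set E := expInt p with hEdef
  have hθc : ContinuousOn θ (Ioo (a - 1) (b + 1)) := fun t ht =>
    (hθ t ht).continuousAt.continuousWithinAt
  set ρ : ℝ → ℝ := fun t => Real.sin (θ t) * Real.cos (θ t) * (lam / E t - E t)
  have hρc : ContinuousOn ρ (Ioo (a - 1) (b + 1)) :=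
    ((Real.continuous_sin.comp_continuousOn hθc).mul
      (Real.continuous_cos.comp_continuousOn hθc)).mul
      (((continuous_const.div hEc fun x => (hE x).ne').sub hEc).continuousOn)
  have ha : a ∈ Ioo (a - 1) (b + 1) := ⟨by linarith, by linarith⟩
  set R : ℝ → ℝ := fun t => Real.exp (∫ x in a..t, ρ x)
  have hR : ∀ t ∈ Ioo (a - 1) (b + 1), HasDerivAt R (R t * ρ t) t := fun t ht => by
    have hsub : uIcc a t ⊆ Ioo (a - 1) (b + 1) := ordConnected_Ioo.uIcc_subset ha ht
    exact (intervalIntegral.integral_hasDerivAt_right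
      ((hρc.mono hsub).intervalIntegrable) (hρc.stronglyMeasurableAtFilter isOpen_Ioo t ht)
      (hρc.continuousAt (Ioo_mem_nhds ht.1 ht.2))).exp
  have hsub : Icc a b ⊆ Ioo (a - 1) (b + 1) := fun t ht =>
    ⟨by linarith [ht.1], by linarith [ht.2]⟩
  have hθpos : ∀ t, 0 < lam / E t * Real.cos (θ t) ^ 2 + E t * Real.sin (θ t) ^ 2 := fun t => by
    have h1 := Real.sin_sq_add_cos_sq (θ t)
    have h2 : 0 < lam / E t := div_pos hlam (hE t)
    rcases (sq_nonneg (Real.cos (θ t))).eq_or_lt with h | h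
    · rw [← h] at h1 ⊢
      have := hE t
      nlinarith
    · have := mul_pos h2 h
      have := mul_nonneg (hE t).le (sq_nonneg (Real.sin (θ t)))
      linarith
  have hY : ∀ t ∈ Icc a b, HasDerivAt (fun t => R t * Real.sin (θ t))
      (lam / E t * (R t * Real.cos (θ t))) t := fun t ht => by
    have h1 := (hR t (hsub ht)).mul (hθ t (hsub ht)).sin
    refine HasDerivAt.congr_deriv h1 ?_
    have h2 := Real.sin_sq_add_cos_sq (θ t)
    have h3 : Real.sin (θ t) ^ 2 = 1 - Real.cos (θ t) ^ 2 := by linarith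
    simp only [ρ]
    linear_combination (R t * Real.cos (θ t) * (lam / E t)) * h2
  -- With R' = ρ R, these satisfy w' = U and (U / E)' = -λ w / E at every point. Only the equation
  -- for U itself needs continuity of p, through E'.
  refine ⟨θ, fun t => -(R t * Real.cos (θ t)), fun t => E t * (R t * Real.sin (θ t)),
    fun t => E t * R t, h0, ?_, fun t ht => hθ t (hsub ht), fun t ht => ?_, fun t ht => ?_,
    fun t => ⟨mul_pos (hE t) (Real.exp_pos _), by ring⟩, fun t ht hpt => ?_⟩
  · refine strictMonoOn_of_deriv_pos (convex_Icc a b) (hθc.mono hsub) fun t ht => ?_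
    rw [(hθ t (hsub (interior_subset ht))).deriv]
    exact hθpos t
  · refine HasDerivAt.congr_deriv ((hR t (hsub ht)).mul (hθ t (hsub ht)).cos).neg ?_
    simp only [ρ]
    have h2 := Real.sin_sq_add_cos_sq (θ t)
    linear_combination (R t * Real.sin (θ t) * E t) * h2
  · exact hEc.continuousAt.mul (hY t ht).continuousAt
  · refine HasDerivAt.congr_deriv ((hasDerivAt_expInt hp hpt).mul (hY t ht)) ?_
    have := (hE t).ne'
    simp only [← hEdef]
    field_simp
    ring

/-! ### Two-point maximum principle -/

/-- A subcritical level of the modulus of continuity: some multiple `C` of `Φ` is crossed by the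
increments of `w`, but only by a small amount. -/
theorem exists_near_optimal_multiple {w Φ : ℝ → ℝ} {a b ε : ℝ} (hab : a < b) (hε : 0 < ε)
    {B m : ℝ} (hm : 0 < m) (hw : ∀ x ∈ Icc a b, ∀ y ∈ Icc a b, x ≤ y → w y - w x ≤ B * (y - x))
    (hwab : w a < w b) (hΦ0 : Φ 0 = 0) (hΦ : ∀ s ∈ Icc 0 ((b - a) / 2), m * s ≤ Φ s)
    {N : ℝ} (hN : ∀ s ∈ Icc 0 ((b - a) / 2), Φ s ≤ N) :
    ∃ C > 0, (∃ x ∈ Icc a b, ∃ y ∈ Icc a b, x < y ∧ C * Φ ((y - x) / 2) < w y - w x) ∧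
      ∀ x ∈ Icc a b, ∀ y ∈ Icc a b, x ≤ y → w y - w x - C * Φ ((y - x) / 2) ≤ ε * C := by
  have hs : ∀ x ∈ Icc a b, ∀ y ∈ Icc a b, x ≤ y → (y - x) / 2 ∈ Icc 0 ((b - a) / 2) :=
    fun x hx y hy hxy => ⟨by linarith, by linarith [hx.1, hy.2]⟩
  have hΦnn : ∀ s ∈ Icc 0 ((b - a) / 2), 0 ≤ Φ s := fun s hs =>
    (mul_nonneg hm.le hs.1).trans (hΦ s hs)
  set S : Set ℝ := {C | 0 ≤ C ∧ ∀ x ∈ Icc a b, ∀ y ∈ Icc a b, x ≤ y →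
    w y - w x ≤ C * Φ ((y - x) / 2)} with hS
  have hne : S.Nonempty := by
    refine ⟨2 * |B| / m, by positivity, fun x hx y hy hxy => ?_⟩
    have h1 := hΦ _ (hs x hx y hy hxy)
    have h2 := hw x hx y hy hxy
    calc w y - w x ≤ |B| * (y - x) := h2.trans (by
          have := le_abs_self B
          gcongr)
      _ = 2 * |B| / m * (m * ((y - x) / 2)) := by field_simp
      _ ≤ _ := by gcongr
  have hbdd : BddBelow S := ⟨0, fun C hC => hC.1⟩
  have hD : (b - a) / 2 ∈ Icc 0 ((b - a) / 2) := ⟨by linarith, le_rfl⟩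
  have hΦab : 0 < Φ ((b - a) / 2) := lt_of_lt_of_le (mul_pos hm (by linarith)) (hΦ _ hD)
  have hab' : a ∈ Icc a b ∧ b ∈ Icc a b := ⟨left_mem_Icc.2 hab.le, right_mem_Icc.2 hab.le⟩
  have hpos : 0 < sInf S := by
    refine lt_of_lt_of_le (div_pos (sub_pos.2 hwab) hΦab) (le_csInf hne fun C hC => ?_)
    rw [div_le_iff₀ hΦab]
    exact hC.2 a hab'.1 b hab'.2 hab.le
  have hNpos : 0 < N := hΦab.trans_le (hN _ hD)
  -- C lies a factor 1 - η below the sharp constant inf S. Comparing with some C' in S below (1 + η)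
  -- inf S, the excess is at most 2 η N inf S ≤ (ε/2) inf S, and η ≤ 1/2 gives inf S ≤ 2 C.
  set η : ℝ := min (1 / 2) (ε / (4 * N)) with hη
  have hη0 : 0 < η := by positivity
  have hη1 : η ≤ 1 / 2 := min_le_left _ _
  have hη2 : η * (4 * N) ≤ ε := by
    rw [← le_div_iff₀ (by positivity)]; exact min_le_right _ _
  set C := (1 - η) * sInf S
  have hC0 : 0 < C := mul_pos (by linarith) hpos
  have hCS : C ∉ S := notMem_of_lt_csInf (by nlinarith) hbdd
  refine ⟨C, hC0, ?_, fun x hx y hy hxy => ?_⟩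
  · simp only [hS, mem_ofPred_eq, not_and, not_forall, not_le] at hCS
    obtain ⟨x, hx, y, hy, hxy, h⟩ := hCS hC0.le
    refine ⟨x, hx, y, hy, lt_of_le_of_ne hxy fun h' => ?_, h⟩
    subst h'
    simp [hΦ0] at h
  · have hsx := hs x hx y hy hxy
    have h0 := hΦnn _ hsx
    have h1 := hN _ hsx
    obtain ⟨C', hC'S, hC'⟩ := exists_lt_of_csInf_lt hne
      (show sInf S < sInf S + η * sInf S by nlinarith)
    have h2 := hC'S.2 x hx y hy hxy
    have h3 : (C' - C) * Φ ((y - x) / 2) ≤ (2 * η * sInf S) * N := by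
      have h4 : C' - C ≤ 2 * η * sInf S := by simp only [C]; linarith
      calc _ ≤ (2 * η * sInf S) * Φ ((y - x) / 2) := by gcongr
        _ ≤ _ := by gcongr
    have h6 : sInf S ≤ 2 * C := by simp only [C]; nlinarith
    have h5 : η * (4 * N) * sInf S ≤ ε * (2 * C) := by gcongr
    linarith

theorem hasDerivAt_nonneg_of_le_left {f : ℝ → ℝ} {f' c x : ℝ} (hc : c < x)
    (h : ∀ y ∈ Ioo c x, f y ≤ f x) (hd : HasDerivAt f f' x) : 0 ≤ f' := by
  have h1 := (hasDerivAt_iff_tendsto_slope_left_right.1 hd).1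
  refine ge_of_tendsto h1 ?_
  filter_upwards [Ioo_mem_nhdsLT hc] with y hy
  rw [slope_def_field]
  exact div_nonneg_of_nonpos (by linarith [h y hy]) (by linarith [hy.2])

theorem hasDerivAt_nonpos_of_le_right {f : ℝ → ℝ} {f' c x : ℝ} (hc : x < c)
    (h : ∀ y ∈ Ioo x c, f y ≤ f x) (hd : HasDerivAt f f' x) : f' ≤ 0 := by
  have h1 := (hasDerivAt_iff_tendsto_slope_left_right.1 hd).2
  refine le_of_tendsto h1 ?_
  filter_upwards [Ioo_mem_nhdsGT hc] with y hy
  rw [slope_def_field]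
  exact div_nonpos_of_nonpos_of_nonneg (by linarith [h y hy]) (by linarith [hy.1])

/-- Two-point maximum principle: if `w'' = 2 p w' - lam w` and `w'` vanishes at both ends of `[a, b]`,
then `p` does not admit a strict modulus with profile `Φ` there. -/
theorem false_of_two_point {p : ℝ → ℝ} (hp : Monotone p) {M : ℝ} (hM : ∀ x, |p x| ≤ M)
    {lam : ℝ} (hlam : 0 < lam) {a b : ℝ} (hab : a < b) {w U : ℝ → ℝ}
    (hw : ∀ t ∈ Icc a b, HasDerivAt w (U t) t) (hUc : ∀ t ∈ Icc a b, ContinuousAt U t)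
    (hU : ∀ t ∈ Icc a b, ContinuousAt p t → HasDerivAt U (2 * p t * U t - lam * w t) t)
    (hUa : U a = 0) (hUb : U b = 0) (hUpos : ∀ t ∈ Ioo a b, 0 < U t)
    {Φ Φ₁ Φ₂ : ℝ → ℝ} (hΦ0 : Φ 0 = 0)
    (hΦ : ∀ s ∈ Icc 0 ((b - a) / 2), HasDerivAt Φ (Φ₁ s) s)
    (hΦ₁ : ∀ s ∈ Icc 0 ((b - a) / 2), HasDerivAt Φ₁ (Φ₂ s) s)
    (hΦ₂ : ContinuousOn Φ₂ (Icc 0 ((b - a) / 2)))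
    (hpos : ∀ s ∈ Icc 0 ((b - a) / 2), 0 < Φ₁ s) {γ : ℝ} (hγ : 0 < γ)
    (hineq : ∀ x ∈ Icc a b, ∀ y ∈ Icc a b, x < y →
      Φ₂ ((y - x) / 2) - (p y - p x) * Φ₁ ((y - x) / 2) + lam * Φ ((y - x) / 2) ≤ -γ) : False := by
  have hD : (0 : ℝ) ≤ (b - a) / 2 := by linarith
  have hwc : ContinuousOn w (Icc a b) := fun t ht => (hw t ht).continuousAt.continuousWithinAt
  have hUc' : ContinuousOn U (Icc a b) := fun t ht => (hUc t ht).continuousWithinAt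
  have hΦc : ContinuousOn Φ (Icc 0 ((b - a) / 2)) := fun t ht =>
    (hΦ t ht).continuousAt.continuousWithinAt
  have hΦ₁c : ContinuousOn Φ₁ (Icc 0 ((b - a) / 2)) := fun t ht =>
    (hΦ₁ t ht).continuousAt.continuousWithinAt
  have hs : ∀ x ∈ Icc a b, ∀ y ∈ Icc a b, x ≤ y → (y - x) / 2 ∈ Icc 0 ((b - a) / 2) :=
    fun x hx y hy hxy => ⟨by linarith, by linarith [hx.1, hy.2]⟩
  obtain ⟨B, hB⟩ := isCompact_Icc.exists_bound_of_continuousOn hUc'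
  obtain ⟨N, hN⟩ := isCompact_Icc.exists_bound_of_continuousOn hΦc
  obtain ⟨s₁, hs₁, hmin⟩ := isCompact_Icc.exists_isMinOn (nonempty_Icc.2 hD) hΦ₁c
  have hwlip : ∀ x ∈ Icc a b, ∀ y ∈ Icc a b, x ≤ y → w y - w x ≤ B * (y - x) := by
    refine (convex_Icc a b).image_sub_le_mul_sub_of_deriv_le hwc
      (fun t ht => (hw t (interior_subset ht)).differentiableAt.differentiableWithinAt)
      fun t ht => ?_
    rw [(hw t (interior_subset ht)).deriv]
    exact (le_abs_self _).trans (hB t (interior_subset ht))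
  have hwmono : StrictMonoOn w (Icc a b) := strictMonoOn_of_deriv_pos (convex_Icc a b) hwc
    fun t ht => by
      rw [(hw t (interior_subset ht)).deriv]
      exact hUpos t (by simpa using ht)
  have hΦlow : ∀ s ∈ Icc 0 ((b - a) / 2), Φ₁ s₁ * s ≤ Φ s := fun s hs => by
    have := (convex_Icc 0 ((b - a) / 2)).mul_sub_le_image_sub_of_le_deriv hΦc
      (fun t ht => (hΦ t (interior_subset ht)).differentiableAt.differentiableWithinAt)
      (C := Φ₁ s₁) (fun t ht => by
        rw [(hΦ t (interior_subset ht)).deriv]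
        exact hmin (interior_subset ht)) 0 ⟨le_rfl, hD⟩ s hs hs.1
    simpa [hΦ0] using this
  -- The crossing makes the maximum below positive, hence off the diagonal. The choice of ε limits
  -- the error in the λ term to C γ / 2, half of the available strictness.
  obtain ⟨C, hC, ⟨x₁, hx₁, y₁, hy₁, hxy₁, hgt⟩, hle⟩ :=
    exists_near_optimal_multiple (ε := γ / (2 * lam)) hab (by positivity) (hpos s₁ hs₁) hwlip
      (hwmono (left_mem_Icc.2 hab.le) (right_mem_Icc.2 hab.le) hab) hΦ0 hΦlow
      (fun s hs => (le_abs_self _).trans (hN s hs))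
  set K : Set (ℝ × ℝ) := (Icc a b ×ˢ Icc a b) ∩ {z | z.1 ≤ z.2} with hK
  have hKc : IsCompact K := (isCompact_Icc.prod isCompact_Icc).inter_right
    (isClosed_le continuous_fst continuous_snd)
  set F : ℝ × ℝ → ℝ := fun z => w z.2 - w z.1 - C * Φ ((z.2 - z.1) / 2) with hF
  have hFc : ContinuousOn F K := by
    refine ((hwc.comp continuousOn_snd fun z hz => hz.1.2).sub
      (hwc.comp continuousOn_fst fun z hz => hz.1.1)).sub (continuousOn_const.mul
      (hΦc.comp (by fun_prop) fun z hz => hs _ hz.1.1 _ hz.1.2 hz.2))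
  obtain ⟨⟨x₀, y₀⟩, hz₀, hmax⟩ := hKc.exists_isMaxOn ⟨(x₁, y₁), ⟨hx₁, hy₁⟩, hxy₁.le⟩ hFc
  have hx₀ : x₀ ∈ Icc a b := hz₀.1.1
  have hy₀ : y₀ ∈ Icc a b := hz₀.1.2
  have hxy₀ : x₀ ≤ y₀ := hz₀.2
  have hmax' : ∀ x ∈ Icc a b, ∀ y ∈ Icc a b, x ≤ y →
      w y - w x - C * Φ ((y - x) / 2) ≤ w y₀ - w x₀ - C * Φ ((y₀ - x₀) / 2) :=
    fun x hx y hy hxy => hmax (show (x, y) ∈ K from ⟨⟨hx, hy⟩, hxy⟩)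
  have hFpos : 0 < w y₀ - w x₀ - C * Φ ((y₀ - x₀) / 2) :=
    (sub_pos.2 hgt).trans_le (hmax' x₁ hx₁ y₁ hy₁ hxy₁.le)
  have hlt : x₀ < y₀ := lt_of_le_of_ne hxy₀ fun h => by simp [h, hΦ0] at hFpos
  set s₀ := (y₀ - x₀) / 2 with hs₀
  have hs₀m := hs x₀ hx₀ y₀ hy₀ hxy₀
  have hΦ₁s₀ := hpos s₀ hs₀m
  have hdy : ∀ y, (y - x₀) / 2 ∈ Icc 0 ((b - a) / 2) → y ∈ Icc a b →
      HasDerivAt (fun y => w y - w x₀ - C * Φ ((y - x₀) / 2))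
      (U y - C * Φ₁ ((y - x₀) / 2) / 2) y := fun y hy hyy => by
    have h1 : HasDerivAt (fun y : ℝ => (y - x₀) / 2) (1 / 2) y :=
      ((hasDerivAt_id y).sub_const x₀).div_const 2
    exact (((hw y hyy).sub_const _).sub (((hΦ _ hy).comp y h1).const_mul C)).congr_deriv (by ring)
  have hdx : ∀ x, (y₀ - x) / 2 ∈ Icc 0 ((b - a) / 2) → x ∈ Icc a b →
      HasDerivAt (fun x => w y₀ - w x - C * Φ ((y₀ - x) / 2))
      (-(U x - C * Φ₁ ((y₀ - x) / 2) / 2)) x := fun x hx hxx => by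
    have h1 : HasDerivAt (fun x : ℝ => (y₀ - x) / 2) (-1 / 2) x :=
      ((hasDerivAt_id x).const_sub y₀).div_const 2
    exact (((hw x hxx).const_sub _).sub (((hΦ _ hx).comp x h1).const_mul C)).congr_deriv (by ring)
  -- w' vanishes at the ends while Φ' > 0, so moving an endpoint inward would increase the
  -- functional: the maximum is interior.
  have hyb : y₀ < b := by
    refine lt_of_le_of_ne hy₀.2 fun h => ?_
    have hd := hdy y₀ hs₀m hy₀
    have hd0 : U y₀ - C * Φ₁ s₀ / 2 < 0 := by rw [h, hUb]; have := mul_pos hC hΦ₁s₀; linarith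
    exact hd0.not_ge (hasDerivAt_nonneg_of_le_left hlt (fun y hy =>
      hmax' x₀ hx₀ y ⟨by linarith [hy.1, hx₀.1], by linarith [hy.2, hy₀.2]⟩ hy.1.le) hd)
  have hax : a < x₀ := by
    refine lt_of_le_of_ne hx₀.1 fun h => ?_
    have hd := hdx x₀ hs₀m hx₀
    have hd0 : 0 < -(U x₀ - C * Φ₁ s₀ / 2) := by
      rw [← h, hUa]; have := mul_pos hC hΦ₁s₀; linarith
    exact hd0.not_ge (hasDerivAt_nonpos_of_le_right hlt (fun x hx =>
      hmax' x ⟨by linarith [hx.1, hx₀.1], by linarith [hx.2, hy₀.2]⟩ y₀ hy₀ hx.2.le) hd)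
  have hUy : U y₀ = C * Φ₁ s₀ / 2 := by
    have hd := hdy y₀ hs₀m hy₀
    refine sub_eq_zero.1 (IsLocalMax.hasDerivAt_eq_zero (f := fun y => w y - w x₀ - C * Φ ((y - x₀) / 2)) ?_ hd)
    filter_upwards [Ioo_mem_nhds hlt hyb] with y hy
    exact hmax' x₀ hx₀ y ⟨by linarith [hy.1, hx₀.1], hy.2.le⟩ hy.1.le
  have hUx : U x₀ = C * Φ₁ s₀ / 2 := by
    have hd := hdx x₀ hs₀m hx₀
    refine sub_eq_zero.1 (neg_eq_zero.1 (IsLocalMax.hasDerivAt_eq_zero (f := fun x => w y₀ - w x - C * Φ ((y₀ - x) / 2)) ?_ hd))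
    filter_upwards [Ioo_mem_nhds hax hlt] with x hx
    exact hmax' x ⟨hx.1.le, by linarith [hx.2, hy₀.2]⟩ y₀ hy₀ hx.2.le
  -- U need not be differentiable where p jumps, so the second derivative test is replaced by
  -- integration. H is the first derivative of the functional along (x₀ - t, y₀ + t), and J is the
  -- derivative of H off a countable set. A positive lower bound on J makes the functional increase
  -- beyond its maximum.
  set J : ℝ → ℝ := fun t => (2 * p (y₀ + t) * U (y₀ + t) - lam * w (y₀ + t)) -
    (2 * p (x₀ - t) * U (x₀ - t) - lam * w (x₀ - t)) - C * Φ₂ (s₀ + t) with hJ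
  set H : ℝ → ℝ := fun t => U (y₀ + t) + U (x₀ - t) - C * Φ₁ (s₀ + t) with hH
  have hM0 : 0 ≤ M := (abs_nonneg _).trans (hM 0)
  -- Replacing each 2 U by C Φ' costs at most M κ, twice. With the error in the λ term this leaves J
  -- ≥ C γ - C γ / 2 - C γ / 4.
  set κ : ℝ := C * γ / (8 * (M + 1)) with hκ
  have hκ0 : 0 < κ := by positivity
  have hκM : M * κ ≤ C * γ / 8 := by
    have : (M + 1) * κ = C * γ / 8 := by rw [hκ]; field_simp
    linarith
  have hΦ₁s : ContinuousAt (fun t => C * Φ₁ (s₀ + t)) 0 :=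
    (ContinuousAt.comp (f := fun t => s₀ + t) (by simpa using (hΦ₁ s₀ hs₀m).continuousAt)
      (by fun_prop)).const_mul C
  have hc1 : ContinuousAt (fun t => |2 * U (y₀ + t) - C * Φ₁ (s₀ + t)|) 0 :=
    (((ContinuousAt.comp (f := fun t => y₀ + t) (by simpa using hUc y₀ hy₀)
      (by fun_prop)).const_mul 2).sub hΦ₁s).abs
  have hc2 : ContinuousAt (fun t => |2 * U (x₀ - t) - C * Φ₁ (s₀ + t)|) 0 :=
    (((ContinuousAt.comp (f := fun t => x₀ - t) (by simpa using hUc x₀ hx₀)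
      (by fun_prop)).const_mul 2).sub hΦ₁s).abs
  have e1 := hc1.eventually_lt (continuousAt_const (y := κ)) (by simpa [hUy] using (by
    rw [show 2 * (C * Φ₁ s₀ / 2) - C * Φ₁ s₀ = 0 by ring, abs_zero]; exact hκ0))
  have e2 := hc2.eventually_lt (continuousAt_const (y := κ)) (by simpa [hUx] using (by
    rw [show 2 * (C * Φ₁ s₀ / 2) - C * Φ₁ s₀ = 0 by ring, abs_zero]; exact hκ0))
  have e3 : ∀ᶠ t in 𝓝 (0 : ℝ), t < min (b - y₀) (x₀ - a) :=
    gt_mem_nhds (lt_min (by linarith) (by linarith))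
  obtain ⟨r, hr, hball⟩ := Metric.eventually_nhds_iff.1 (e1.and (e2.and e3))
  set t₁ := r / 2 with ht₁
  have ht₁0 : 0 < t₁ := by positivity
  have hprop : ∀ t ∈ Icc 0 t₁, |2 * U (y₀ + t) - C * Φ₁ (s₀ + t)| < κ ∧
      |2 * U (x₀ - t) - C * Φ₁ (s₀ + t)| < κ ∧ t < min (b - y₀) (x₀ - a) := fun t ht =>
    hball (by rw [Real.dist_eq, sub_zero, abs_of_nonneg ht.1]; linarith [ht.2])
  have hyt : ∀ t ∈ Icc 0 t₁, y₀ + t ∈ Icc a b := fun t ht =>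
    ⟨by linarith [ht.1, hy₀.1], by linarith [(lt_min_iff.1 (hprop t ht).2.2).1]⟩
  have hxt : ∀ t ∈ Icc 0 t₁, x₀ - t ∈ Icc a b := fun t ht =>
    ⟨by linarith [(lt_min_iff.1 (hprop t ht).2.2).2], by linarith [ht.1, hx₀.2]⟩
  have hst : ∀ t, (y₀ + t - (x₀ - t)) / 2 = s₀ + t := fun t => by rw [hs₀]; ring
  have hsm : ∀ t ∈ Icc 0 t₁, s₀ + t ∈ Icc 0 ((b - a) / 2) := fun t ht => by
    rw [← hst]; exact hs _ (hxt t ht) _ (hyt t ht) (by linarith [ht.1])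
  have hJ0 : ∀ t ∈ Icc 0 t₁, C * γ / 4 ≤ J t := fun t ht => by
    have h1 := hineq _ (hxt t ht) _ (hyt t ht) (by linarith [ht.1])
    have h2 := hle _ (hxt t ht) _ (hyt t ht) (by linarith [ht.1])
    rw [hst] at h1 h2
    obtain ⟨h3, h4, -⟩ := hprop t ht
    have h5 : |p (y₀ + t) * (2 * U (y₀ + t) - C * Φ₁ (s₀ + t))| ≤ M * κ := by
      rw [abs_mul]; exact mul_le_mul (hM _) h3.le (abs_nonneg _) hM0
    have h6 : |p (x₀ - t) * (2 * U (x₀ - t) - C * Φ₁ (s₀ + t))| ≤ M * κ := by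
      rw [abs_mul]; exact mul_le_mul (hM _) h4.le (abs_nonneg _) hM0
    have h7 := mul_le_mul_of_nonneg_left h1 hC.le
    have h8 := mul_le_mul_of_nonneg_left h2 hlam.le
    have h9 : lam * (γ / (2 * lam) * C) = C * γ / 2 := by field_simp
    rw [h9] at h8
    have h5' := neg_le_of_abs_le h5
    have h6' := le_of_abs_le h6
    simp only [hJ]
    linarith
  set Z : Set ℝ := (fun t => y₀ + t) ⁻¹' {x | ¬ContinuousAt p x} ∪
    (fun t => x₀ - t) ⁻¹' {x | ¬ContinuousAt p x} with hZ
  have hZc : Z.Countable :=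
    (hp.countable_not_continuousAt.preimage (add_right_injective y₀)).union
      (hp.countable_not_continuousAt.preimage (sub_right_injective))
  have hshift : ∀ t, HasDerivAt (fun t => y₀ + t) 1 t := fun t => (hasDerivAt_id t).const_add y₀
  have hshift' : ∀ t, HasDerivAt (fun t => x₀ - t) (-1) t := fun t =>
    (hasDerivAt_id t).const_sub x₀
  have hshifts : ∀ t, HasDerivAt (fun t => s₀ + t) 1 t := fun t => (hasDerivAt_id t).const_add s₀
  have hcU1 : ContinuousOn (fun t => U (y₀ + t)) (Icc 0 t₁) :=
    hUc'.comp (by fun_prop) hyt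
  have hcU2 : ContinuousOn (fun t => U (x₀ - t)) (Icc 0 t₁) :=
    hUc'.comp (by fun_prop) hxt
  have hcw1 : ContinuousOn (fun t => w (y₀ + t)) (Icc 0 t₁) :=
    hwc.comp (by fun_prop) hyt
  have hcw2 : ContinuousOn (fun t => w (x₀ - t)) (Icc 0 t₁) :=
    hwc.comp (by fun_prop) hxt
  have hHc : ContinuousOn H (Icc 0 t₁) :=
    (hcU1.add hcU2).sub (continuousOn_const.mul (hΦ₁c.comp (by fun_prop) hsm))
  have hHd : ∀ t ∈ Icc 0 t₁ \ Z, HasDerivAt H (J t) t := fun t ht => by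
    obtain ⟨ht, htZ⟩ := ht
    simp only [hZ, mem_union, mem_preimage, mem_ofPred_eq, not_or, not_not] at htZ
    exact ((((hU _ (hyt t ht) htZ.1).comp t (hshift t)).add
      ((hU _ (hxt t ht) htZ.2).comp t (hshift' t))).sub
      (((hΦ₁ _ (hsm t ht)).comp t (hshifts t)).const_mul C)).congr_deriv
        (by simp only [hJ]; ring)
  have hJi : IntervalIntegrable J volume 0 t₁ := by
    have hu : uIcc 0 t₁ = Icc 0 t₁ := uIcc_of_le ht₁0.le
    have i1 : IntervalIntegrable (fun t => 2 * p (y₀ + t)) volume 0 t₁ :=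
      (Monotone.intervalIntegrable fun u v huv => hp (by linarith)).const_mul 2
    have i2 : IntervalIntegrable (fun t => 2 * p (x₀ - t)) volume 0 t₁ :=
      (Antitone.intervalIntegrable fun u v huv => hp (by linarith)).const_mul 2
    refine ((i1.mul_continuousOn (hu ▸ hcU1)).sub
      (ContinuousOn.intervalIntegrable (hu ▸ continuousOn_const.mul hcw1))).sub
      ((i2.mul_continuousOn (hu ▸ hcU2)).sub
      (ContinuousOn.intervalIntegrable (hu ▸ continuousOn_const.mul hcw2))) |>.sub
      (ContinuousOn.intervalIntegrable (hu ▸ continuousOn_const.mul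
        (hΦ₂.comp (by fun_prop) hsm)))
  have hH0 : H 0 = 0 := by simp only [hH, add_zero, sub_zero, hUy, hUx]; ring
  have hHpos : ∀ t ∈ Ioc 0 t₁, 0 < H t := fun t ht => by
    have hsub : Icc 0 t ⊆ Icc 0 t₁ := Icc_subset_Icc_right ht.2
    have hi : IntervalIntegrable J volume 0 t := hJi.mono_set (by
      rw [uIcc_of_le ht.1.le, uIcc_of_le ht₁0.le]; exact hsub)
    have h1 := integral_eq_of_hasDerivAt_off_countable_of_le H J ht.1.le hZc (hHc.mono hsub)
      (fun x hx => hHd x ⟨hsub (Ioo_subset_Icc_self hx.1), hx.2⟩) hi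
    have h2 : ∫ _ in (0 : ℝ)..t, C * γ / 4 ≤ ∫ x in (0 : ℝ)..t, J x :=
      intervalIntegral.integral_mono_on ht.1.le (by simp) hi fun x hx => hJ0 x (hsub hx)
    rw [h1, hH0, intervalIntegral.integral_const, sub_zero, smul_eq_mul, sub_zero] at h2
    have := mul_pos ht.1 (show 0 < C * γ / 4 by positivity)
    linarith
  have hG : StrictMonoOn (fun t => w (y₀ + t) - w (x₀ - t) - C * Φ (s₀ + t)) (Icc 0 t₁) := by
    refine strictMonoOn_of_deriv_pos (convex_Icc _ _)
      ((hcw1.sub hcw2).sub (continuousOn_const.mul (hΦc.comp (by fun_prop) hsm))) fun t ht => ?_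
    rw [interior_Icc] at ht
    have ht' := Ioo_subset_Icc_self ht
    have h1 : HasDerivAt (fun t => w (y₀ + t) - w (x₀ - t) - C * Φ (s₀ + t)) (H t) t :=
      ((((hw _ (hyt t ht')).comp t (hshift t)).sub
      ((hw _ (hxt t ht')).comp t (hshift' t))).sub
      (((hΦ _ (hsm t ht')).comp t (hshifts t)).const_mul C)).congr_deriv
        (by simp only [hH]; ring)
    rw [h1.deriv]
    exact hHpos t ⟨ht.1, ht.2.le⟩
  have h1 := hG ⟨le_rfl, ht₁0.le⟩ ⟨ht₁0.le, le_rfl⟩ ht₁0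
  have h2 := hmax' _ (hxt t₁ ⟨ht₁0.le, le_rfl⟩) _ (hyt t₁ ⟨ht₁0.le, le_rfl⟩) (by linarith)
  rw [hst] at h2
  simp only [add_zero, sub_zero] at h1
  linarith

/-! ### Riccati equation and Hardy type inequality -/

/-- By the fundamental theorem of calculus f is a primitive of f' up to a constant. This admits η,
whose equation fails at the jumps of p, into integration by parts. -/
theorem absolutelyContinuous_of_hasDerivAt_off_countable {f f' : ℝ → ℝ} {a b : ℝ} (hab : a ≤ b)
    {s : Set ℝ} (hs : s.Countable) (hc : ContinuousOn f (Icc a b))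
    (hd : ∀ x ∈ Ioo a b \ s, HasDerivAt f (f' x) x) (hi : IntervalIntegrable f' volume a b) :
    AbsolutelyContinuousOnInterval f a b := by
  have h1 := hi.absolutelyContinuousOnInterval_intervalIntegral (c := a) left_mem_uIcc
  have h2 : AbsolutelyContinuousOnInterval (fun _ : ℝ => f a) a b :=
    (LipschitzWith.const (f a)).lipschitzOnWith.absolutelyContinuousOnInterval
  have h3 := h1.fun_add h2
  refine (absolutelyContinuousOnInterval_iff _ _ _).2 fun ε hε => ?_
  obtain ⟨δ, hδ, h⟩ := (absolutelyContinuousOnInterval_iff _ _ _).1 h3 ε hε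
  have key : ∀ x ∈ uIcc a b, (∫ t in a..x, f' t) + f a = f x := fun x hx => by
    rw [uIcc_of_le hab] at hx
    rw [integral_eq_of_hasDerivAt_off_countable_of_le f f' hx.1 hs
      (hc.mono (Icc_subset_Icc_right hx.2)) (fun y hy => hd y ⟨⟨hy.1.1, hy.1.2.trans_le hx.2⟩, hy.2⟩)
      (hi.mono_set (by rw [uIcc_of_le hx.1, uIcc_of_le hab]; exact Icc_subset_Icc_right hx.2))]
    ring
  refine ⟨δ, hδ, fun E hE hE' => ?_⟩
  have := h E hE hE'
  refine lt_of_eq_of_lt (Finset.sum_congr rfl fun i hi => ?_) this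
  rw [key _ (hE.1 i hi).1, key _ (hE.1 i hi).2]

theorem intervalIntegrable_bdd_mul {p : ℝ → ℝ} (hp : Measurable p) {M : ℝ} (hM : ∀ x, |p x| ≤ M)
    {f : ℝ → ℝ} {a b : ℝ} (hf : IntervalIntegrable f volume a b) :
    IntervalIntegrable (fun x => p x * f x) volume a b :=
  ⟨hf.1.bdd_mul hp.aestronglyMeasurable (ae_of_all _ hM),
    hf.2.bdd_mul hp.aestronglyMeasurable (ae_of_all _ hM)⟩

/-- The form `∫ (z' - p z) ^ 2`, expanded. -/
theorem integral_deriv_sub_mul_sq {p : ℝ → ℝ} (hp : Measurable p) {M : ℝ} (hM : ∀ x, |p x| ≤ M)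
    {z : ℝ → ℝ} {a b : ℝ} (hz : AbsolutelyContinuousOnInterval z a b)
    (hz2 : IntervalIntegrable (fun x => deriv z x ^ 2) volume a b) :
    IntervalIntegrable (fun x => (deriv z x - p x * z x) ^ 2) volume a b ∧
    ∫ x in a..b, (deriv z x - p x * z x) ^ 2 = (∫ x in a..b, deriv z x ^ 2) -
      (∫ x in a..b, p x * (2 * (z x * deriv z x))) + ∫ x in a..b, (p x * z x) ^ 2 := by
  have hzc : ContinuousOn z (uIcc a b) := hz.continuousOn
  have h1 : IntervalIntegrable (fun x => p x * (2 * (z x * deriv z x))) volume a b :=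
    intervalIntegrable_bdd_mul hp hM ((hz.intervalIntegrable_deriv.continuousOn_mul hzc).const_mul 2)
  have h2 : IntervalIntegrable (fun x => (p x * z x) ^ 2) volume a b := by
    refine (intervalIntegrable_bdd_mul hp hM (intervalIntegrable_bdd_mul hp hM
      (hzc.pow 2).intervalIntegrable)).congr fun x _ => ?_
    simp only [Pi.pow_apply]; ring
  have h3 : (fun x => (deriv z x - p x * z x) ^ 2) =
      fun x => deriv z x ^ 2 - p x * (2 * (z x * deriv z x)) + (p x * z x) ^ 2 := by
    funext x; ring
  rw [h3]
  exact ⟨(hz2.sub h1).add h2, by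
    rw [intervalIntegral.integral_add (hz2.sub h1) h2, intervalIntegral.integral_sub hz2 h1]⟩

/-- A positive solution of the Riccati equation gives a lower bound on the quadratic form. -/
theorem integral_sq_le_of_riccati {p η : ℝ → ℝ} (hp : Monotone p) {M : ℝ}
    (hM : ∀ x, |p x| ≤ M) {lam a b : ℝ} (hab : a ≤ b)
    (hηc : ContinuousOn η (Icc a b))
    (hη : ∀ t ∈ Icc a b, ContinuousAt p t → HasDerivAt η (-lam - η t ^ 2 - 2 * p t * η t) t)
    {z : ℝ → ℝ} (hz : AbsolutelyContinuousOnInterval z a b) (hza : z a = 0) (hzb : z b = 0)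
    (hz2 : IntervalIntegrable (fun x => deriv z x ^ 2) volume a b) :
    lam * ∫ x in a..b, z x ^ 2 ≤ ∫ x in a..b, (deriv z x - p x * z x) ^ 2 := by
  have hu : uIcc a b = Icc a b := uIcc_of_le hab
  have hpi : IntervalIntegrable p volume a b := hp.intervalIntegrable
  have hηi : IntervalIntegrable (fun t => -lam - η t ^ 2 - 2 * p t * η t) volume a b :=
    (ContinuousOn.intervalIntegrable (hu ▸ (continuousOn_const.sub (hηc.pow 2)))).sub
      ((hpi.const_mul 2).mul_continuousOn (hu ▸ hηc))
  have hηac : AbsolutelyContinuousOnInterval η a b :=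
    absolutelyContinuous_of_hasDerivAt_off_countable hab hp.countable_not_continuousAt hηc
      (fun x hx => hη x (Ioo_subset_Icc_self hx.1) (not_not.1 hx.2)) hηi
  have hzz := hz.fun_mul hz
  have hIBP := hηac.integral_deriv_mul_eq_sub hzz
  simp only [hza, hzb, mul_zero, sub_zero] at hIBP
  have hzc : ContinuousOn z (uIcc a b) := hz.continuousOn
  have hz2i : IntervalIntegrable (fun x => z x ^ 2) volume a b := (hzc.pow 2).intervalIntegrable
  have hk := (integral_deriv_sub_mul_sq hp.measurable hM hz hz2).1
  rw [← intervalIntegral.integral_const_mul]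
  have hbi : IntervalIntegrable (fun x => deriv η x * (z x * z x) + η x * deriv (fun x => z x * z x) x)
      volume a b :=
    (hηac.intervalIntegrable_deriv.mul_continuousOn hzz.continuousOn).add
      (hzz.intervalIntegrable_deriv.continuousOn_mul hηac.continuousOn)
  rw [← sub_nonneg, ← intervalIntegral.integral_sub hk (hz2i.const_mul _), ← hIBP]
  refine intervalIntegral.integral_mono_ae_restrict hab hbi (hk.sub (hz2i.const_mul _)) ?_
  have hae : ∀ᵐ x ∂volume.restrict (Icc a b), ContinuousAt p x :=
    ae_restrict_of_ae (hp.countable_not_continuousAt.ae_notMem _ |>.mono fun x hx => not_not.1 hx)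
  filter_upwards [hae, ae_restrict_mem measurableSet_Icc, ae_restrict_of_ae hz.ae_differentiableAt]
    with x hx hxm hzx
  have hd := (hzx (hu ▸ hxm)).hasDerivAt
  rw [(hη x hxm hx).deriv, (hd.fun_mul hd).deriv]
  -- By the Riccati equation, (z' - p z)² - λ z² - (η z²)' is exactly this square.
  have := sq_nonneg (deriv z x - p x * z x - η x * z x)
  linarith

/-- The Hardy type inequality attached to a modulus of monotonicity. -/
theorem integral_sq_le_of_modulus {p : ℝ → ℝ} (hp : Monotone p) {M : ℝ} (hM : ∀ x, |p x| ≤ M)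
    {lam : ℝ} (hlam : 0 < lam) {A D : ℝ} (hD : 0 < D) (hDA : D < A)
    {Φ Φ₁ Φ₂ : ℝ → ℝ} (hΦ0 : Φ 0 = 0)
    (hΦ : ∀ s ∈ Icc 0 A, HasDerivAt Φ (Φ₁ s) s)
    (hΦ₁ : ∀ s ∈ Icc 0 A, HasDerivAt Φ₁ (Φ₂ s) s)
    (hΦ₂ : ContinuousOn Φ₂ (Icc 0 A))
    (hpos : ∀ s ∈ Icc 0 A, 0 < Φ₁ s) {γ : ℝ} (hγ : 0 < γ)
    (hineq : ∀ x ∈ Icc (-A) A, ∀ y ∈ Icc (-A) A, x < y →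
      Φ₂ ((y - x) / 2) - (p y - p x) * Φ₁ ((y - x) / 2) + lam * Φ ((y - x) / 2) ≤ -γ)
    {z : ℝ → ℝ} (hz : AbsolutelyContinuousOnInterval z (-D) D) (hza : z (-D) = 0) (hzb : z D = 0)
    (hz2 : IntervalIntegrable (fun x => deriv z x ^ 2) volume (-D) D) :
    lam * ∫ x in (-D)..D, z x ^ 2 ≤ ∫ x in (-D)..D, (deriv z x - p x * z x) ^ 2 := by
  obtain ⟨θ, w, U, R, h0, hmono, hθ, hw, hUc, hUR, hU⟩ :=
    exists_shooting hp hlam (show -A < A by linarith)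
  have hθc : ContinuousOn θ (Icc (-A) A) := fun t ht => (hθ t ht).continuousAt.continuousWithinAt
  have hA : -A ∈ Icc (-A) A := ⟨le_rfl, by linarith⟩
  have hθpos : ∀ t ∈ Ioc (-A) A, 0 < θ t := fun t ht =>
    h0 ▸ hmono hA (Ioc_subset_Icc_self ht) ht.1
  have hlt : ∀ t ∈ Icc (-A) A, θ t < Real.pi := fun t ht => by
    -- Where θ first equals π, U = w' vanishes again, so w' is zero at both ends of [-A, b] and
    -- positive between them.
    by_contra! hge
    have hAt : -A ≤ t := ht.1
    obtain ⟨b, hb, hbπ⟩ := intermediate_value_Icc hAt (hθc.mono (Icc_subset_Icc_right ht.2))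
      (show Real.pi ∈ Icc (θ (-A)) (θ t) from ⟨by rw [h0]; exact Real.pi_pos.le, hge⟩)
    have hbA : b ≤ A := hb.2.trans ht.2
    have hab : -A < b := lt_of_le_of_ne hb.1 fun h => by
      rw [← h, h0] at hbπ; exact Real.pi_pos.ne hbπ
    have hsub : Icc (-A) b ⊆ Icc (-A) A := Icc_subset_Icc_right hbA
    have hsub' : Icc 0 ((b - -A) / 2) ⊆ Icc 0 A := Icc_subset_Icc_right (by linarith)
    refine false_of_two_point hp hM hlam hab (fun t ht => hw t (hsub ht))
      (fun t ht => hUc t (hsub ht)) (fun t ht => hU t (hsub ht)) (by simp [(hUR _).2, h0])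
      (by simp [(hUR _).2, hbπ]) (fun t ht => ?_) hΦ0 (fun s hs => hΦ s (hsub' hs))
      (fun s hs => hΦ₁ s (hsub' hs)) (hΦ₂.mono hsub') (fun s hs => hpos s (hsub' hs)) hγ
      (fun x hx y hy => hineq x (hsub hx) y (hsub hy))
    rw [(hUR t).2]
    have ht' := hsub (Ioo_subset_Icc_self ht)
    exact mul_pos (hUR t).1 (Real.sin_pos_of_pos_of_lt_pi (hθpos t ⟨ht.1, ht'.2⟩)
      (hbπ ▸ hmono ht' ⟨hab.le, hbA⟩ ht.2))
  have hsub : Icc (-D) D ⊆ Icc (-A) A := Icc_subset_Icc (by linarith) hDA.le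
  have hsin : ∀ t ∈ Icc (-D) D, 0 < Real.sin (θ t) := fun t ht =>
    Real.sin_pos_of_pos_of_lt_pi (hθpos t ⟨by linarith [ht.1], (hsub ht).2⟩) (hlt t (hsub ht))
  have hEc := continuous_expInt hp
  have hE := expInt_pos p
  -- This is η = -λ w / w'. It is singular at -A, where θ = 0; D < A keeps [-D, D] away from that
  -- point.
  refine integral_sq_le_of_riccati hp hM (η := fun t => lam * Real.cos (θ t) / (expInt p t * Real.sin (θ t)))
    (by linarith) ?_ (fun t ht hpt => ?_) hz hza hzb hz2
  · exact (continuousOn_const.mul (Real.continuous_cos.comp_continuousOn (hθc.mono hsub))).div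
      (hEc.continuousOn.mul (Real.continuous_sin.comp_continuousOn (hθc.mono hsub)))
      fun t ht => (mul_pos (hE t) (hsin t ht)).ne'
  · have h1 := hθ t (hsub ht)
    have h2 := (hsin t ht).ne'
    have h3 := (hE t).ne'
    refine ((h1.cos.const_mul lam).div ((hasDerivAt_expInt hp hpt).mul h1.sin)
      (mul_pos (hE t) (hsin t ht)).ne').congr_deriv ?_
    have h4 := Real.sin_sq_add_cos_sq (θ t)
    simp only [Pi.mul_apply]
    field_simp
    linear_combination (-(lam * Real.cos (θ t) ^ 2 + Real.sin (θ t) ^ 2 * expInt p t ^ 2)) * h4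

/-! ### Integration by parts against ψ' -/

/-- Integration by parts against the derivative measure of a monotone function. -/
theorem setLIntegral_sq_derivMeasure {p : ℝ → ℝ} {α β A D : ℝ} (hp : MonotoneOn p (Ioo α β))
    (hα : α < -A) (hβ : A < β) (hD : 0 < D) (hDA : D < A) {z : ℝ → ℝ}
    (hz : AbsolutelyContinuousOnInterval z (-D) D) (hza : z (-D) = 0) (hzb : z D = 0) :
    ∫⁻ x in Ioc (-D) D, ENNReal.ofReal (z x ^ 2) ∂(derivMeasure p α β) =
      ENNReal.ofReal (-∫ t in (-D)..D, clamp p (-A) A t * (2 * (z t * deriv z t))) := by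
  have hpA : MonotoneOn p (Icc (-A) A) := hp.mono fun x hx =>
    ⟨hα.trans_le hx.1, hx.2.trans_lt hβ⟩
  have hP := clamp_monotone (show -A ≤ A by linarith) hpA
  set P := clamp p (-A) A
  set R := Function.rightLim P with hR
  have hRm : Monotone R := hP.rightLim
  set k : ℝ → ℝ := fun t => 2 * (z t * deriv z t) with hkdef
  set μ := derivMeasure p α β
  have hzc : ContinuousOn z (uIcc (-D) D) := hz.continuousOn
  have hki : IntervalIntegrable k volume (-D) D :=
    (hz.intervalIntegrable_deriv.continuousOn_mul hzc).const_mul 2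
  have hDD : -D ≤ D := by linarith
  have hu : uIcc (-D) D = Icc (-D) D := uIcc_of_le hDD
  have hμ : ∀ x y, -D ≤ x → x ≤ y → y ≤ D → μ (Ioc x y) = ENNReal.ofReal (R y - R x) :=
    fun x y hx hxy hy => by
      rw [derivMeasure_Ioc hp (by linarith) hxy (by linarith),
        ← clamp_rightLim hpA ⟨by linarith, by linarith⟩,
        ← clamp_rightLim hpA ⟨by linarith, by linarith⟩]
  have hk : ∀ x ∈ Icc (-D) D, ∫ t in (-D)..x, k t = z x ^ 2 := fun x hx => by
    have hzx : AbsolutelyContinuousOnInterval z (-D) x := hz.mono (by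
      rw [uIcc_of_le hx.1, hu]; exact Icc_subset_Icc_right hx.2)
    have := hzx.integral_deriv_mul_eq_sub hzx
    rw [hza] at this
    rw [← sub_zero (z x ^ 2), sq, ← mul_zero (0 : ℝ), ← this]
    congr 1; funext t; simp only [hkdef]; ring
  have : IsFiniteMeasure (μ.restrict (Ioc (-D) D)) := ⟨by
    rw [Measure.restrict_apply_univ, hμ _ _ le_rfl hDD le_rfl]; exact ENNReal.ofReal_lt_top⟩
  have hki' : Integrable k (volume.restrict (Ioc (-D) D)) := hki.1
  have hmeas : MeasurableSet {q : ℝ × ℝ | q.2 < q.1} := measurableSet_lt measurable_snd measurable_fst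
  have hjoint : Integrable (fun q : ℝ × ℝ => {q : ℝ × ℝ | q.2 < q.1}.indicator (fun q => k q.2) q)
      ((μ.restrict (Ioc (-D) D)).prod (volume.restrict (Ioc (-D) D))) :=
    (hki'.comp_snd _).indicator hmeas
  -- Fubini on the triangle t < x: z(x)² is the integral of k up to x, and the other order produces
  -- the mass R(D) - R(t) of (t, D]. The R(D) term drops out because k has integral z(D)² = 0.
  have hswap := integral_integral_swap (f := fun x t =>
    {q : ℝ × ℝ | q.2 < q.1}.indicator (fun q => k q.2) (x, t)) hjoint
  have h1 : ∫ x in Ioc (-D) D, (∫ t in Ioc (-D) D,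
      {q : ℝ × ℝ | q.2 < q.1}.indicator (fun q => k q.2) (x, t)) ∂μ =
      ∫ x in Ioc (-D) D, z x ^ 2 ∂μ := by
    refine setIntegral_congr_fun measurableSet_Ioc fun x hx => ?_
    have e : (fun t => {q : ℝ × ℝ | q.2 < q.1}.indicator (fun q => k q.2) (x, t)) =
        (Iio x).indicator k := by
      funext t; simp [indicator]
    simp only [e]
    rw [setIntegral_indicator measurableSet_Iio, ← hk x (Ioc_subset_Icc_self hx),
      intervalIntegral.integral_of_le hx.1.le, integral_Ioc_eq_integral_Ioo]
    congr 2
    ext t; simp only [mem_inter_iff, mem_Ioc, mem_Iio, mem_Ioo]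
    exact ⟨fun h => ⟨h.1.1, h.2⟩, fun h => ⟨⟨h.1, h.2.le.trans hx.2⟩, h.2⟩⟩
  have h2 : ∫ t in Ioc (-D) D, ∫ x in Ioc (-D) D,
      {q : ℝ × ℝ | q.2 < q.1}.indicator (fun q => k q.2) (x, t) ∂μ =
      ∫ t in Ioc (-D) D, (R D * k t - R t * k t) := by
    refine setIntegral_congr_fun measurableSet_Ioc fun t ht => ?_
    have e : (fun x => {q : ℝ × ℝ | q.2 < q.1}.indicator (fun q => k q.2) (x, t)) =
        (Ioi t).indicator (fun _ => k t) := by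
      funext x; simp [indicator]
    simp only [e]
    rw [setIntegral_indicator measurableSet_Ioi, setIntegral_const,
      show Ioc (-D) D ∩ Ioi t = Ioc t D by
        ext x; simp only [mem_inter_iff, mem_Ioc, mem_Ioi]
        exact ⟨fun h => ⟨h.2, h.1.2⟩, fun h => ⟨⟨ht.1.trans h.1, h.2⟩, h.1⟩⟩,
      measureReal_def, hμ _ _ ht.1.le ht.2 le_rfl,
      ENNReal.toReal_ofReal (sub_nonneg.2 (hRm ht.2)), smul_eq_mul, sub_mul]
  have hRP : ∀ᵐ t ∂volume.restrict (Ioc (-D) D), R t * k t = P t * k t := by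
    refine ae_restrict_of_ae ?_
    filter_upwards [hP.countable_not_continuousAt.ae_notMem volume] with t ht
    rw [hR, (not_not.1 ht).continuousWithinAt.rightLim_eq]
  have hPk : IntegrableOn (fun t => P t * k t) (Ioc (-D) D) := by
    have hM : ∀ x, |P x| ≤ max |p (-A)| |p A| := fun x => by
      have h1 : -A ≤ max (-A) (min x A) := le_max_left _ _
      have h2 : max (-A) (min x A) ≤ A := max_le (by linarith) (min_le_right _ _)
      exact abs_le_max_abs_abs (hpA ⟨le_rfl, by linarith⟩ ⟨h1, h2⟩ h1)
        (hpA ⟨h1, h2⟩ ⟨by linarith, le_rfl⟩ h2)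
    exact (intervalIntegrable_bdd_mul hP.measurable hM hki).1
  rw [← ofReal_integral_eq_lintegral_ofReal ?_ (ae_of_all _ fun x => sq_nonneg _)]
  · congr 1
    rw [← h1, hswap, h2, integral_sub (hki'.const_mul _) (hPk.congr (hRP.mono fun _ h => h.symm)),
      integral_const_mul, ← intervalIntegral.integral_of_le hDD, hk D ⟨hDD, le_rfl⟩, hzb,
      integral_congr_ae hRP, intervalIntegral.integral_of_le hDD]
    simp [hkdef]
  · obtain ⟨B, hB⟩ := isCompact_uIcc.exists_bound_of_continuousOn (hzc.pow 2)
    refine Integrable.of_bound (((hu ▸ hzc).pow 2).mono Ioc_subset_Icc_self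
      |>.aestronglyMeasurable measurableSet_Ioc) B ?_
    filter_upwards [ae_restrict_mem measurableSet_Ioc] with x hx
    exact hB x (hu ▸ Ioc_subset_Icc_self hx)

/-! ### Soft thresholding and passage to the eigenvalue -/

/-- Soft thresholding at level `ε`. -/
noncomputable def softThreshold (ε y : ℝ) : ℝ := y - max (-ε) (min y ε)

theorem softThreshold_eq_zero {ε y : ℝ} (h : |y| ≤ ε) : softThreshold ε y = 0 := by
  have := abs_le.1 h
  simp [softThreshold, min_eq_left this.2, max_eq_right this.1]

theorem abs_softThreshold_sub_le (ε x y : ℝ) :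
    |softThreshold ε x - softThreshold ε y| ≤ |x - y| := by
  wlog hxy : x ≤ y generalizing x y
  · rw [abs_sub_comm, abs_sub_comm x]; exact this y x (le_of_not_ge hxy)
  rw [abs_sub_comm, abs_sub_comm x, abs_of_nonneg (sub_nonneg.2 hxy), abs_le]
  simp only [softThreshold]
  have h1 : max (-ε) (min x ε) ≤ max (-ε) (min y ε) := max_le_max le_rfl (min_le_min hxy le_rfl)
  have h2 : max (-ε) (min y ε) - max (-ε) (min x ε) ≤ y - x := by
    rcases max_cases (-ε) (min y ε) with h | h <;> rcases max_cases (-ε) (min x ε) with h' | h' <;>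
    rcases min_cases y ε with h3 | h3 <;> rcases min_cases x ε with h4 | h4 <;> linarith
  constructor <;> linarith

theorem abs_softThreshold_le {ε : ℝ} (hε : 0 ≤ ε) (x : ℝ) : |softThreshold ε x| ≤ |x| := by
  simpa [softThreshold_eq_zero (show |(0 : ℝ)| ≤ ε by simpa)] using abs_softThreshold_sub_le ε x 0

theorem tendsto_softThreshold (y : ℝ) {e : ℕ → ℝ} (he : Tendsto e atTop (𝓝 0)) :
    Tendsto (fun n => softThreshold (e n) y) atTop (𝓝 y) := by
  have h : Tendsto (fun n => y - max (-e n) (min y (e n))) atTop (𝓝 (y - max (-0) (min y 0))) :=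
    tendsto_const_nhds.sub (he.neg.max (tendsto_const_nhds.min he))
  simpa [softThreshold] using h

theorem continuous_softThreshold (ε : ℝ) : Continuous (softThreshold ε) := by
  unfold softThreshold; fun_prop

theorem absolutelyContinuous_softThreshold {v : ℝ → ℝ} {a b : ℝ} (ε : ℝ)
    (hv : AbsolutelyContinuousOnInterval v a b) :
    AbsolutelyContinuousOnInterval (fun x => softThreshold ε (v x)) a b := by
  refine (absolutelyContinuousOnInterval_iff _ _ _).2 fun δ hδ => ?_
  obtain ⟨r, hr, h⟩ := (absolutelyContinuousOnInterval_iff _ _ _).1 hv δ hδ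
  exact ⟨r, hr, fun E hE hE' => lt_of_le_of_lt
    (Finset.sum_le_sum fun i _ => abs_softThreshold_sub_le ε _ _) (h E hE hE')⟩

theorem abs_deriv_le_of_abs_sub_le {v z : ℝ → ℝ} (h : ∀ x y, |z x - z y| ≤ |v x - v y|) {x : ℝ}
    (hv : DifferentiableAt ℝ v x) : |deriv z x| ≤ |deriv v x| := by
  by_cases hz : DifferentiableAt ℝ z x
  · refine le_of_tendsto_of_tendsto (hasDerivAt_iff_tendsto_slope.1 hz.hasDerivAt).abs
      (hasDerivAt_iff_tendsto_slope.1 hv.hasDerivAt).abs (Eventually.of_forall fun y => ?_)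
    simp only [slope_def_field, abs_div]
    exact div_le_div_of_nonneg_right (h _ _) (abs_nonneg _)
  -- `deriv` is 0 where z is not differentiable, so the bound is trivial there.
  · simp [deriv_zero_of_not_differentiableAt hz]

/-- A function continuous on `[-B, B]` that vanishes at both ends is small near the ends. -/
theorem exists_forall_abs_le_near_ends {v : ℝ → ℝ} {B ε : ℝ} (hB : 0 < B) (hε : 0 < ε)
    (hv : ContinuousOn v (Icc (-B) B)) (hl : v (-B) = 0) (hr : v B = 0) :
    ∃ D, 0 < D ∧ D < B ∧ ∀ x ∈ Icc (-B) B, D ≤ |x| → |v x| ≤ ε := by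
  obtain ⟨δ₁, hδ₁, h₁⟩ := Metric.continuousWithinAt_iff.1 (hv B ⟨by linarith, le_rfl⟩) ε hε
  obtain ⟨δ₂, hδ₂, h₂⟩ := Metric.continuousWithinAt_iff.1 (hv (-B) ⟨le_rfl, by linarith⟩) ε hε
  have hδ : 0 < min (min δ₁ δ₂) B := by positivity
  have e1 : min (min δ₁ δ₂) B ≤ δ₁ := (min_le_left _ _).trans (min_le_left _ _)
  have e2 : min (min δ₁ δ₂) B ≤ δ₂ := (min_le_left _ _).trans (min_le_right _ _)
  have e3 : min (min δ₁ δ₂) B ≤ B := min_le_right _ _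
  refine ⟨B - min (min δ₁ δ₂) B / 2, by linarith, by linarith, fun x hx hDx => ?_⟩
  rcases le_abs.1 hDx with h | h
  · have := h₁ hx (by rw [Real.dist_eq, abs_lt]; constructor <;> linarith [hx.1, hx.2])
    rw [hr, Real.dist_eq, sub_zero] at this
    exact this.le
  · have := h₂ hx (by rw [Real.dist_eq, abs_lt]; constructor <;> linarith [hx.1, hx.2])
    rw [hl, Real.dist_eq, sub_zero] at this
    exact this.le

/-- The energy of a compactly supported function, bounded below through the quadratic form
`∫ (z' - p z) ^ 2`. -/
theorem ofReal_mul_lintegral_le_energy {ψ : ℝ → EReal} {B A D lam : ℝ} (hD : 0 < D) (hDA : D < A)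
    (hAB : A < B) (hp : MonotoneOn (fun x => (ψ x).toReal) (Ioo (-B) B)) (hlam : 0 ≤ lam)
    (hform : ∀ z : ℝ → ℝ, AbsolutelyContinuousOnInterval z (-D) D → z (-D) = 0 → z D = 0 →
      IntervalIntegrable (fun x => deriv z x ^ 2) volume (-D) D →
      lam * ∫ x in (-D)..D, z x ^ 2 ≤
        ∫ x in (-D)..D, (deriv z x - clamp (fun x => (ψ x).toReal) (-A) A x * z x) ^ 2)
    {v z : ℝ → ℝ} (hvz : ∀ x y, |z x - z y| ≤ |v x - v y|) (hvz' : ∀ x, |z x| ≤ |v x|)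
    (hv : MemH10 (-B) B v) (hz : AbsolutelyContinuousOnInterval z (-D) D)
    (hz0 : ∀ x ∈ Icc (-B) B, D ≤ |x| → z x = 0) :
    ∫⁻ x in Ioo (-B) B, ENNReal.ofReal lam * ENNReal.ofReal (z x ^ 2) ≤
      (∫⁻ x in Ioo (-B) B, ENNReal.ofReal (deriv v x ^ 2)) +
        ∫⁻ x in Ioo (-B) B, ENNReal.ofReal (v x ^ 2) ∂(potential ψ (-B) B) := by
  set p : ℝ → ℝ := fun x => (ψ x).toReal with hpdef
  have hDD : -D ≤ D := by linarith
  have hu : uIcc (-D) D = Icc (-D) D := uIcc_of_le hDD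
  have hpA : MonotoneOn p (Icc (-A) A) := hp.mono fun x hx =>
    ⟨by linarith [hx.1], by linarith [hx.2]⟩
  have hP := clamp_monotone (show -A ≤ A by linarith) hpA
  set P := clamp p (-A) A with hPdef
  have hM : ∀ x, |P x| ≤ max |p (-A)| |p A| := fun x => by
    have h1 : -A ≤ max (-A) (min x A) := le_max_left _ _
    have h2 : max (-A) (min x A) ≤ A := max_le (by linarith) (min_le_right _ _)
    exact abs_le_max_abs_abs (hpA ⟨le_rfl, by linarith⟩ ⟨h1, h2⟩ h1)
      (hpA ⟨h1, h2⟩ ⟨by linarith, le_rfl⟩ h2)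
  have hsub : Ioc (-D) D ⊆ Ioo (-B) B := fun x hx => ⟨by linarith [hx.1], by linarith [hx.2]⟩
  have hza : z (-D) = 0 := hz0 _ ⟨by linarith, by linarith⟩ (by rw [abs_neg]; exact le_abs_self D)
  have hzb : z D = 0 := hz0 _ ⟨by linarith, by linarith⟩ (le_abs_self D)
  have hsq : ∀ x, z x ^ 2 ≤ v x ^ 2 := fun x => sq_le_sq.2 (hvz' x)
  have hdsq : ∀ᵐ x ∂volume.restrict (Ioc (-D) D), deriv z x ^ 2 ≤ deriv v x ^ 2 := by
    filter_upwards [ae_restrict_of_ae hv.absCont.ae_differentiableAt,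
      ae_restrict_mem measurableSet_Ioc] with x hx hxm
    refine sq_le_sq.2 (abs_deriv_le_of_abs_sub_le hvz (hx ?_))
    rw [uIcc_of_le (by linarith)]
    exact Ioo_subset_Icc_self (hsub hxm)
  have hz2 : IntervalIntegrable (fun x => deriv z x ^ 2) volume (-D) D := by
    rw [intervalIntegrable_iff_integrableOn_Ioc_of_le hDD]
    have h1 : IntegrableOn (fun x => deriv v x ^ 2) (Ioo (-B) B) := hv.deriv_memLp.integrable_sq
    refine (h1.mono_set hsub).mono' ((measurable_deriv z).pow_const 2).aestronglyMeasurable ?_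
    filter_upwards [hdsq] with x hx
    rwa [Real.norm_eq_abs, abs_of_nonneg (sq_nonneg _)]
  obtain ⟨-, hexp⟩ := integral_deriv_sub_mul_sq hP.measurable hM hz hz2
  have hkey := hform z hz hza hzb hz2
  rw [hexp] at hkey
  have hzc : ContinuousOn z (uIcc (-D) D) := hz.continuousOn
  have hz2i : IntervalIntegrable (fun x => z x ^ 2) volume (-D) D := (hzc.pow 2).intervalIntegrable
  have hPz : IntervalIntegrable (fun x => (P x * z x) ^ 2) volume (-D) D := by
    refine (intervalIntegrable_bdd_mul hP.measurable hM (intervalIntegrable_bdd_mul hP.measurable hM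
      hz2i)).congr fun x _ => ?_
    ring
  have hconv : ∀ f : ℝ → ℝ, (∀ x, 0 ≤ f x) → IntervalIntegrable f volume (-D) D →
      ENNReal.ofReal (∫ x in (-D)..D, f x) = ∫⁻ x in Ioc (-D) D, ENNReal.ofReal (f x) :=
    fun f hf hfi => by
      rw [intervalIntegral.integral_of_le hDD]
      exact ofReal_integral_eq_lintegral_ofReal
        ((intervalIntegrable_iff_integrableOn_Ioc_of_le hDD).1 hfi) (ae_of_all _ hf)
  have hL : ∫⁻ x in Ioo (-B) B, ENNReal.ofReal lam * ENNReal.ofReal (z x ^ 2) =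
      ENNReal.ofReal (lam * ∫ x in (-D)..D, z x ^ 2) := by
    rw [ENNReal.ofReal_mul hlam, hconv _ (fun x => sq_nonneg _) hz2i,
      lintegral_const_mul' _ _ ENNReal.ofReal_ne_top]
    congr 1
    rw [← lintegral_inter_add_sdiff _ _ (measurableSet_Ioc (a := -D) (b := D)),
      inter_eq_right.2 hsub,
      setLIntegral_congr_fun (g := fun _ => 0) (measurableSet_Ioo.diff measurableSet_Ioc)
        fun x hx => ?_, lintegral_zero, add_zero]
    have : z x = 0 := hz0 x (Ioo_subset_Icc_self hx.1) (by
      by_contra! h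
      exact hx.2 ⟨(abs_lt.1 h).1, (abs_lt.1 h).2.le⟩)
    simp [this]
  rw [hL]
  refine (ENNReal.ofReal_le_ofReal hkey).trans ?_
  rw [sub_eq_add_neg]
  refine ENNReal.ofReal_add_le.trans ((add_le_add_left ENNReal.ofReal_add_le _).trans ?_)
  rw [add_assoc]
  refine add_le_add ?_ ?_
  · rw [hconv _ (fun x => sq_nonneg _) hz2]
    refine (lintegral_mono_ae ?_).trans (lintegral_mono_set hsub)
    filter_upwards [hdsq] with x hx
    exact ENNReal.ofReal_le_ofReal hx
  · rw [potential, Measure.restrict_add, lintegral_add_measure]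
    refine add_le_add ?_ ?_
    · rw [← setLIntegral_sq_derivMeasure hp (by linarith) hAB hD hDA hz hza hzb]
      refine (lintegral_mono fun x => ?_).trans (lintegral_mono_set hsub)
      exact ENNReal.ofReal_le_ofReal (hsq x)
    · rw [hconv _ (fun x => sq_nonneg _) hPz, restrict_withDensity measurableSet_Ioo,
        Measure.restrict_restrict measurableSet_Ioo, inter_self]
      have hvm : AEMeasurable (fun x => ENNReal.ofReal (v x ^ 2)) (volume.restrict (Ioo (-B) B)) := by
        have := (hv.absCont.continuousOn.mono (by
          rw [uIcc_of_le (by linarith)]; exact Ioo_subset_Icc_self)).aemeasurable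
          (μ := volume) measurableSet_Ioo
        exact (this.pow_const 2).ennreal_ofReal
      have hpm : AEMeasurable (fun x => ENNReal.ofReal (p x ^ 2)) (volume.restrict (Ioo (-B) B)) :=
        ((aemeasurable_restrict_of_monotoneOn measurableSet_Ioo hp).pow_const 2).ennreal_ofReal
      rw [lintegral_withDensity_eq_lintegral_mul₀ hpm hvm]
      refine (setLIntegral_mono_ae' measurableSet_Ioc ?_).trans (lintegral_mono_set hsub)
      refine ae_of_all _ fun x hx => ?_
      rw [Pi.mul_apply, ← ENNReal.ofReal_mul (sq_nonneg _)]
      refine ENNReal.ofReal_le_ofReal ?_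
      rw [hPdef, clamp_of_mem ⟨by linarith [hx.1], by linarith [hx.2]⟩, mul_pow]
      exact mul_le_mul_of_nonneg_left (hsq x) (sq_nonneg _)

/-- Lower bounds on the quadratic form of compactly supported functions pass to `gapEigenvalue`. -/
theorem ofReal_le_gapEigenvalue {ψ : ℝ → EReal} {d lam : ℝ} (hd : 0 < d) (hlam : 0 ≤ lam)
    (hp : MonotoneOn (fun x => (ψ x).toReal) (centred d))
    (hform : ∀ A D, 0 < D → D < A → A < d / 2 → ∀ z : ℝ → ℝ,
      AbsolutelyContinuousOnInterval z (-D) D → z (-D) = 0 → z D = 0 →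
      IntervalIntegrable (fun x => deriv z x ^ 2) volume (-D) D →
      lam * ∫ x in (-D)..D, z x ^ 2 ≤
        ∫ x in (-D)..D, (deriv z x - clamp (fun x => (ψ x).toReal) (-A) A x * z x) ^ 2) :
    ENNReal.ofReal lam ≤ gapEigenvalue d ψ := by
  set B := d / 2 with hBdef
  have hB : 0 < B := by positivity
  have hBB : uIcc (-B) B = Icc (-B) B := uIcc_of_le (by linarith)
  refine le_iInf₂ fun v hv => ?_
  obtain ⟨hv, -, x₀, hx₀, hvx₀⟩ := hv
  have hvc : ContinuousOn v (Icc (-B) B) := hBB ▸ hv.absCont.continuousOn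
  have hvm : AEMeasurable v (volume.restrict (Ioo (-B) B)) :=
    (hvc.mono Ioo_subset_Icc_self).aemeasurable measurableSet_Ioo
  -- Thresholding shrinks |v| and |v'| pointwise, so the energy of v itself dominates. No
  -- convergence of energies is needed, although the potential may have infinite mass near the ends.
  have hstep : ∀ ε > 0, ∫⁻ x in Ioo (-B) B,
      ENNReal.ofReal lam * ENNReal.ofReal (softThreshold ε (v x) ^ 2) ≤
      (∫⁻ x in Ioo (-B) B, ENNReal.ofReal (deriv v x ^ 2)) +
        ∫⁻ x in Ioo (-B) B, ENNReal.ofReal (v x ^ 2) ∂(potential ψ (-B) B) := fun ε hε => by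
    obtain ⟨D, hD, hDB, hsmall⟩ := exists_forall_abs_le_near_ends hB hε hvc hv.left hv.right
    have hA1 : D < (D + B) / 2 := by linarith
    have hA2 : (D + B) / 2 < B := by linarith
    refine ofReal_mul_lintegral_le_energy hD hA1 hA2 hp hlam (hform _ D hD hA1 hA2)
      (fun x y => abs_softThreshold_sub_le ε _ _) (fun x => abs_softThreshold_le hε.le _) hv
      ((absolutelyContinuous_softThreshold ε hv.absCont).mono ?_)
      fun x hx hDx => softThreshold_eq_zero (hsmall x hx hDx)
    rw [hBB, uIcc_of_le (by linarith)]
    exact Icc_subset_Icc (by linarith) hDB.le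
  set V := ∫⁻ x in Ioo (-B) B, ENNReal.ofReal (v x ^ 2)
  have hV0 : V ≠ 0 := fun h => by
    have h1 := (lintegral_eq_zero_iff' (hvm.pow_const 2).ennreal_ofReal).1 h
    have h2 : v =ᵐ[volume.restrict (Ioo (-B) B)] fun _ => 0 := by
      filter_upwards [h1] with x hx
      simpa using hx
    exact hvx₀ (Measure.eqOn_open_of_ae_eq h2 isOpen_Ioo (hvc.mono Ioo_subset_Icc_self)
      continuousOn_const hx₀)
  have hVt : V ≠ ⊤ := by
    have h1 : IntegrableOn (fun x => v x ^ 2) (Ioo (-B) B) :=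
      ((hvc.pow 2).integrableOn_Icc).mono_set Ioo_subset_Icc_self
    refine ne_of_eq_of_ne (ofReal_integral_eq_lintegral_ofReal h1
      (ae_of_all _ fun x => sq_nonneg _)).symm ?_
    exact ENNReal.ofReal_ne_top
  rw [rayleigh, ENNReal.le_div_iff_mul_le (Or.inl hV0) (Or.inl hVt),
    ← lintegral_const_mul' _ _ ENNReal.ofReal_ne_top]
  have he : Tendsto (fun n : ℕ => 1 / ((n : ℝ) + 1)) atTop (𝓝 0) :=
    tendsto_one_div_add_atTop_nhds_zero_nat
  have hlim : ∀ x, Tendsto (fun n : ℕ => ENNReal.ofReal lam *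
      ENNReal.ofReal (softThreshold (1 / ((n : ℝ) + 1)) (v x) ^ 2)) atTop
      (𝓝 (ENNReal.ofReal lam * ENNReal.ofReal (v x ^ 2))) := fun x =>
    ENNReal.Tendsto.const_mul (ENNReal.tendsto_ofReal ((tendsto_softThreshold (v x) he).pow 2))
      (Or.inr ENNReal.ofReal_ne_top)
  -- Fatou's lemma, as the upper bound does not depend on ε.
  calc _ = ∫⁻ x in Ioo (-B) B, liminf (fun n : ℕ => ENNReal.ofReal lam *
      ENNReal.ofReal (softThreshold (1 / ((n : ℝ) + 1)) (v x) ^ 2)) atTop :=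
        lintegral_congr fun x => (hlim x).liminf_eq.symm
    _ ≤ _ := lintegral_liminf_le' fun n =>
        (((continuous_softThreshold _).measurable.comp_aemeasurable hvm).pow_const
          2).ennreal_ofReal.const_mul _
    _ ≤ _ := liminf_le_of_frequently_le' (Frequently.of_forall fun n =>
        hstep _ (by positivity))

/-- Lower bound for the first eigenvalue in terms of one-dimensional comparison profiles. -/
theorem ofReal_le_gapEigenvalue_of_profile {ψ : ℝ → EReal} {d lam : ℝ} (hd : 0 < d)
    (hlam : 0 < lam) (hp : MonotoneOn (fun x => (ψ x).toReal) (centred d))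
    (hprof : ∀ A, 0 < A → A < d / 2 → ∃ (lam' γ : ℝ) (Φ Φ₁ Φ₂ : ℝ → ℝ), lam ≤ lam' ∧ 0 < γ ∧
      Φ 0 = 0 ∧ (∀ s ∈ Icc 0 A, HasDerivAt Φ (Φ₁ s) s) ∧
      (∀ s ∈ Icc 0 A, HasDerivAt Φ₁ (Φ₂ s) s) ∧ ContinuousOn Φ₂ (Icc 0 A) ∧
      (∀ s ∈ Icc 0 A, 0 < Φ₁ s) ∧ ∀ x ∈ centred d, ∀ y ∈ centred d, x < y → (y - x) / 2 ≤ A →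
        Φ₂ ((y - x) / 2) - ((ψ y).toReal - (ψ x).toReal) * Φ₁ ((y - x) / 2) +
          lam' * Φ ((y - x) / 2) ≤ -γ) :
    ENNReal.ofReal lam ≤ gapEigenvalue d ψ := by
  refine ofReal_le_gapEigenvalue hd hlam.le hp fun A D hD hDA hAd z hz hza hzb hz2 => ?_
  obtain ⟨lam', γ, Φ, Φ₁, Φ₂, hle, hγ, h0, h1, h2, h3, h4, h5⟩ := hprof A (hD.trans hDA) hAd
  have hsub : Icc (-A) A ⊆ centred d := fun x hx => ⟨by linarith [hx.1], by linarith [hx.2]⟩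
  have hpA := hp.mono hsub
  have hAA : -A ≤ A := by linarith
  have hM : ∀ x, |clamp (fun x => (ψ x).toReal) (-A) A x| ≤
      max |(ψ (-A)).toReal| |(ψ A).toReal| := fun x => by
    have h1 : -A ≤ max (-A) (min x A) := le_max_left _ _
    have h2 : max (-A) (min x A) ≤ A := max_le hAA (min_le_right _ _)
    exact abs_le_max_abs_abs (hpA ⟨le_rfl, hAA⟩ ⟨h1, h2⟩ h1) (hpA ⟨h1, h2⟩ ⟨hAA, le_rfl⟩ h2)
  refine le_trans ?_ (integral_sq_le_of_modulus (clamp_monotone hAA hpA) hM (hlam.trans_le hle) hD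
    hDA h0 h1 h2 h3 h4 hγ (fun x hx y hy hxy => ?_) hz hza hzb hz2)
  · exact mul_le_mul_of_nonneg_right hle
      (intervalIntegral.integral_nonneg (by linarith) fun x _ => sq_nonneg _)
  · rw [clamp_of_mem hx, clamp_of_mem hy]
    exact h5 x (hsub hx) y (hsub hy) hxy (by linarith [hx.1, hy.2])

/-! ### Profile for the modulus 2 tan -/

/-- The operator Φ'' - 2 tan Φ' + 3 Φ kills sin and sends tan to 3 tan. Subtracting κ tan from sin
thus leaves room 3 κ tan s, which pays for raising λ by 2 κ. The term in sin² makes the inequality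
strict at s = 0. -/
theorem ofReal_le_gapEigenvalue_of_tan_modulus {ψ : ℝ → EReal} {d : ℝ} (hd : 0 < d)
    (hdπ : d ≤ Real.pi) (hp : MonotoneOn (fun x => (ψ x).toReal) (centred d))
    (hmod : ∀ x ∈ centred d, ∀ y ∈ centred d, x < y →
      2 * Real.tan ((y - x) / 2) ≤ (ψ y).toReal - (ψ x).toReal) :
    ENNReal.ofReal (3 + Real.cos (d / 2) ^ 3) ≤ gapEigenvalue d ψ := by
  have hcd : 0 ≤ Real.cos (d / 2) := Real.cos_nonneg_of_mem_Icc ⟨by linarith, by linarith⟩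
  refine ofReal_le_gapEigenvalue_of_profile hd (by positivity) hp fun A hA hAd => ?_
  -- This ensures κ / cos² ≤ cos / 2 up to A, which keeps Φ' positive. The gain 2 κ = cos³ A is at
  -- least cos³(d/2).
  set κ : ℝ := Real.cos A ^ 3 / 2 with hκ
  have hcos : ∀ s ∈ Icc 0 A, 0 < Real.cos s := fun s hs =>
    Real.cos_pos_of_mem_Ioo ⟨by linarith [hs.1], by linarith [hs.2]⟩
  have hcA := hcos A ⟨hA.le, le_rfl⟩
  have hκ0 : 0 < κ := by positivity
  have hκ1 : κ ≤ 1 / 2 := by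
    have := pow_le_one₀ (n := 3) hcA.le (Real.cos_le_one A)
    rw [hκ]; linarith
  have hcle : ∀ s ∈ Icc 0 A, 2 * κ ≤ Real.cos s ^ 3 := fun s hs => by
    have := Real.cos_le_cos_of_nonneg_of_le_pi hs.1 (by linarith [Real.pi_pos]) hs.2
    have := pow_le_pow_left₀ hcA.le this 3
    rw [hκ]; linarith
  have hpos : ∀ s ∈ Icc 0 A,
      0 < Real.cos s - κ / Real.cos s ^ 2 - 2 * κ / 5 * (Real.sin s * Real.cos s) := fun s hs => by
    have hc := hcos s hs
    have h1 : κ / Real.cos s ^ 2 ≤ Real.cos s / 2 := by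
      rw [div_le_iff₀ (by positivity)]
      linarith [hcle s hs, show Real.cos s / 2 * Real.cos s ^ 2 = Real.cos s ^ 3 / 2 by ring]
    have h2 : 2 * κ / 5 * (Real.sin s * Real.cos s) ≤ 1 / 5 * (1 * Real.cos s) := by
      gcongr
      · have := Real.sin_nonneg_of_nonneg_of_le_pi hs.1 (by linarith [hs.2, Real.pi_pos])
        positivity
      · linarith
      · exact Real.sin_le_one s
    linarith
  refine ⟨3 + 2 * κ, 2 * κ / 5,
    fun s => Real.sin s - κ * Real.tan s - κ / 5 * Real.sin s ^ 2,
    fun s => Real.cos s - κ / Real.cos s ^ 2 - 2 * κ / 5 * (Real.sin s * Real.cos s),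
    fun s => -Real.sin s - 2 * κ * Real.sin s / Real.cos s ^ 3 -
      2 * κ / 5 * (Real.cos s ^ 2 - Real.sin s ^ 2), ?_, by positivity, by simp,
    fun s hs => ?_, fun s hs => ?_, ?_, hpos, fun x hx y hy hxy hs => ?_⟩
  · have := Real.cos_le_cos_of_nonneg_of_le_pi hA.le (by linarith) hAd.le
    have := pow_le_pow_left₀ hcd this 3
    rw [hκ]; linarith
  · have hc := (hcos s hs).ne'
    refine (((Real.hasDerivAt_sin s).sub ((Real.hasDerivAt_tan hc).const_mul κ)).sub
      (((Real.hasDerivAt_sin s).pow 2).const_mul (κ / 5))).congr_deriv ?_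
    push_cast; ring
  · have hc := (hcos s hs).ne'
    refine (((Real.hasDerivAt_cos s).sub ((((Real.hasDerivAt_cos s).pow 2).inv
      (pow_ne_zero 2 hc)).const_mul κ)).sub
      (((Real.hasDerivAt_sin s).mul (Real.hasDerivAt_cos s)).const_mul (2 * κ / 5))).congr_deriv ?_
    simp only [Pi.pow_apply]
    push_cast
    field_simp
    ring
  · refine ((Real.continuous_sin.neg.continuousOn).sub (ContinuousOn.div (by fun_prop) (by fun_prop)
      fun s hs => pow_ne_zero 3 (hcos s hs).ne')).sub (by fun_prop)
  · set s := (y - x) / 2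
    have hsm : s ∈ Icc 0 A := ⟨by simp only [s]; linarith, hs⟩
    have hc := hcos s hsm
    have h1 := mul_le_mul_of_nonneg_right (hmod x hx y hy hxy) (hpos s hsm).le
    have hu0 := Real.sin_nonneg_of_nonneg_of_le_pi hsm.1 (by linarith [Real.pi_pos])
    have hu1 := Real.sin_le_one s
    have hsc := Real.sin_sq_add_cos_sq s
    have ht : Real.sin s ≤ Real.tan s := by
      rw [Real.tan_eq_sin_div_cos, le_div_iff₀ hc]
      exact mul_le_of_le_one_right hu0 (Real.cos_le_one s)
    have h2 : 2 * Real.tan s * (Real.cos s - κ / Real.cos s ^ 2 -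
        2 * κ / 5 * (Real.sin s * Real.cos s)) =
        2 * Real.sin s - 2 * κ * Real.sin s / Real.cos s ^ 3 - 4 * κ / 5 * Real.sin s ^ 2 := by
      rw [Real.tan_eq_sin_div_cos]; field_simp; ring
    have h3 : Real.cos s ^ 2 = 1 - Real.sin s ^ 2 := by linarith
    have h4 : 0 ≤ κ * (Real.tan s - Real.sin s) := mul_nonneg hκ0.le (by linarith)
    have h5 : 0 ≤ κ * (κ * Real.tan s) := by have := hu0.trans ht; positivity
    have h6 : 0 ≤ κ * (κ * Real.sin s ^ 2) := by positivity
    have h7 : 0 ≤ κ * (Real.sin s * (1 - Real.sin s)) := by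
      have : 0 ≤ 1 - Real.sin s := by linarith
      positivity
    simp only [h3] at h1 h2 ⊢
    nlinarith

/-! ### Profile for a modulus improved on long intervals -/

/-- The polynomial part of the comparison profile used when the modulus is strictly larger than
`2 tan` on long intervals. -/
theorem profile_inequality {δ u c e : ℝ} (hδ0 : 0 < δ) (hδ1 : δ ≤ 1) (hu0 : 0 ≤ u) (hu1 : u ≤ 1)
    (hc : 0 ≤ c) (huc : u ^ 2 + c ^ 2 = 1) (he : 0 ≤ e) (hcase : u ≤ 571 / 1000 ∨ δ ≤ e) :
    (-(3 * δ / 10) * (2 * u - 4 * u ^ 3) - δ / 1250) * c ^ 2 -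
      3 * u * (1 - 3 * δ / 10 * (u ^ 2 - u ^ 4) - δ / 1250 * u) -
      e * (c * (1 - 3 * δ / 10 * (u ^ 2 - u ^ 4) - δ / 1250 * u)) +
      (3 + δ / 500) * (u - δ / 10 * (u ^ 3 - 3 / 5 * u ^ 5) - δ / 2500 * u ^ 2) ≤ -(δ / 2500) := by
  have hu2 : u ^ 2 ≤ u := by nlinarith
  obtain ⟨y, hy⟩ : ∃ y, y = u ^ 2 := ⟨_, rfl⟩
  have hy0 : 0 ≤ y := hy ▸ sq_nonneg u
  rw [← hy] at hu2 huc
  have hy1 : y ≤ 1 := hu2.trans hu1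
  -- On functions g(u) of u = sin s, the operator for 2 tan and λ = 3 is (1 - u²) g'' - 3 u g' + 3
  -- g. It kills u, sends u³ - 3/5 u⁵ to -u P, and sends u² to 2 - 5 u².
  obtain ⟨P, hP⟩ : ∃ P, P = -6 + 24 * y - 96 / 5 * y ^ 2 := ⟨_, rfl⟩
  set g' := 1 - 3 * δ / 10 * (u ^ 2 - u ^ 4) - δ / 1250 * u with hg'
  have hg'9 : 9 / 10 ≤ g' := by
    have h0 : u ^ 2 - u ^ 4 = y * (1 - y) := by rw [hy]; ring
    have h1 : y * (1 - y) ≤ 1 / 4 := by nlinarith only [sq_nonneg (y - 1 / 2)]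
    have h2 : δ * (y * (1 - y)) ≤ 1 * (1 / 4) :=
      mul_le_mul hδ1 h1 (mul_nonneg hy0 (by linarith)) zero_le_one
    have h3 : δ * u ≤ 1 * 1 := mul_le_mul hδ1 hu1 hu0 zero_le_one
    rw [hg', h0]; linarith
  have hE : 0 ≤ e * (c * g') := by positivity
  have key : u / 10 * P - (2 - 5 * y) / 2500 + u / 500 - e * (c * g') / δ ≤ -(1 / 2500) := by
    have hE' : 0 ≤ e * (c * g') / δ := by positivity
    -- P is negative for small u and for u near 1. In between P ≤ 3/2, and the extra modulus, worth
    -- at least 0.252 after division by δ, outweighs u P / 10 ≤ 0.15.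
    by_cases h1 : u ≤ 571 / 1000
    · have hP' : P ≤ -1 / 5 := by
        have : y ≤ 327 / 1000 := by rw [hy]; nlinarith only [h1, hu0]
        nlinarith only [this, hy0, hP]
      have := mul_le_mul_of_nonneg_left hP' (show 0 ≤ u / 10 by positivity)
      linarith
    · by_cases h2 : 92 / 100 ≤ y
      · have hP' : P ≤ -1 / 10 := by nlinarith only [h2, hy1, hP]
        have := mul_le_mul_of_nonneg_left hP' (show 0 ≤ u / 10 by positivity)
        linarith
      · have he' := hcase.resolve_left h1
        have hc' : 28 / 100 ≤ c := by nlinarith only [h2, huc, hc]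
        have h3 : 252 / 1000 ≤ e * (c * g') / δ := by
          rw [le_div_iff₀ hδ0]
          have h4 : 28 / 100 * (9 / 10) ≤ c * g' := by gcongr
          have h5 : δ * (28 / 100 * (9 / 10)) ≤ e * (c * g') := by gcongr
          linarith
        have hP' : P ≤ 3 / 2 := by nlinarith only [sq_nonneg (y - 5 / 8), hP]
        have := mul_le_mul_of_nonneg_left hP' (show 0 ≤ u / 10 by positivity)
        linarith
  have hk := mul_le_mul_of_nonneg_left key hδ0.le
  have h4 : δ * (u / 10 * P - (2 - 5 * y) / 2500 + u / 500 - e * (c * g') / δ) =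
      δ * (u / 10 * P - (2 - 5 * y) / 2500 + u / 500) - e * (c * g') := by field_simp
  rw [h4] at hk
  -- The terms of second order in δ, from the raised λ acting on the perturbation, have a favourable
  -- sign.
  have h5 : 0 ≤ δ * (δ * u ^ 3 * (1 - 3 / 5 * u ^ 2)) := by
    have : 0 ≤ 1 - 3 / 5 * u ^ 2 := by rw [← hy]; linarith
    positivity
  have h6 : 0 ≤ δ * (δ * u ^ 2) := by positivity
  have hc2 : c ^ 2 = 1 - u ^ 2 := by rw [← hy]; linarith
  rw [hP, hy] at hk
  rw [hc2]
  linear_combination hk + h5 / 5000 + h6 / 1250000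

theorem ofReal_le_gapEigenvalue_of_improved_modulus {ψ : ℝ → EReal} {d δ : ℝ} (hd : 0 < d)
    (hdπ : d ≤ Real.pi) (hδ0 : 0 < δ) (hδ1 : δ ≤ 1)
    (hp : MonotoneOn (fun x => (ψ x).toReal) (centred d))
    (hmod : ∀ x ∈ centred d, ∀ y ∈ centred d, x < y →
      2 * Real.tan ((y - x) / 2) ≤ (ψ y).toReal - (ψ x).toReal)
    (hmod' : ∀ x ∈ centred d, ∀ y ∈ centred d, 6 / 5 < y - x →
      2 * Real.tan ((y - x) / 2) + δ ≤ (ψ y).toReal - (ψ x).toReal) :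
    ENNReal.ofReal (3 + δ / 500) ≤ gapEigenvalue d ψ := by
  refine ofReal_le_gapEigenvalue_of_profile hd (by positivity) hp fun A hA hAd => ?_
  have hcos : ∀ s ∈ Icc 0 A, 0 < Real.cos s := fun s hs =>
    Real.cos_pos_of_mem_Ioo ⟨by linarith [hs.1], by linarith [hs.2]⟩
  have hsin : ∀ s ∈ Icc 0 A, 0 ≤ Real.sin s := fun s hs =>
    Real.sin_nonneg_of_nonneg_of_le_pi hs.1 (by linarith [hs.2, Real.pi_pos])
  have hpos : ∀ s ∈ Icc 0 A, 0 < Real.cos s * (1 - 3 * δ / 10 * (Real.sin s ^ 2 - Real.sin s ^ 4) -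
      δ / 1250 * Real.sin s) := fun s hs => by
    have hu0 := hsin s hs
    have hu1 := Real.sin_le_one s
    refine mul_pos (hcos s hs) ?_
    have h1 : Real.sin s ^ 2 - Real.sin s ^ 4 ≤ 1 / 4 := by
      nlinarith [sq_nonneg (Real.sin s ^ 2 - 1 / 2)]
    nlinarith
  refine ⟨3 + δ / 500, δ / 2500,
    fun s => Real.sin s - δ / 10 * (Real.sin s ^ 3 - 3 / 5 * Real.sin s ^ 5) -
      δ / 2500 * Real.sin s ^ 2,
    fun s => Real.cos s * (1 - 3 * δ / 10 * (Real.sin s ^ 2 - Real.sin s ^ 4) -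
      δ / 1250 * Real.sin s),
    fun s => (-(3 * δ / 10) * (2 * Real.sin s - 4 * Real.sin s ^ 3) - δ / 1250) * Real.cos s ^ 2 -
      Real.sin s * (1 - 3 * δ / 10 * (Real.sin s ^ 2 - Real.sin s ^ 4) - δ / 1250 * Real.sin s),
    le_rfl, by positivity, by simp, fun s hs => ?_, fun s hs => ?_, by fun_prop, hpos,
    fun x hx y hy hxy hs => ?_⟩
  · have h := Real.hasDerivAt_sin s
    refine ((h.sub (((h.pow 3).sub ((h.pow 5).const_mul (3 / 5))).const_mul (δ / 10))).sub
      ((h.pow 2).const_mul (δ / 2500))).congr_deriv ?_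
    push_cast; ring
  · have h := Real.hasDerivAt_sin s
    refine ((Real.hasDerivAt_cos s).mul ((((hasDerivAt_const s (1 : ℝ)).sub
      (((h.pow 2).sub (h.pow 4)).const_mul (3 * δ / 10)))).sub
      (h.const_mul (δ / 1250)))).congr_deriv ?_
    simp only [Pi.sub_apply, Pi.pow_apply]
    push_cast; ring
  · set s := (y - x) / 2 with hsdef
    have hsm : s ∈ Icc 0 A := ⟨by simp only [s]; linarith, hs⟩
    have hc := hcos s hsm
    have hΦ₁ := (hpos s hsm).le
    have hsc := Real.sin_sq_add_cos_sq s
    set g' := 1 - 3 * δ / 10 * (Real.sin s ^ 2 - Real.sin s ^ 4) - δ / 1250 * Real.sin s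
    have ht : ∀ e, (2 * Real.tan s + e) * (Real.cos s * g') =
        2 * Real.sin s * g' + e * (Real.cos s * g') := fun e => by
      rw [Real.tan_eq_sin_div_cos]; field_simp
    rcases le_or_gt s (3 / 5) with h35 | h35
    · have h1 := mul_le_mul_of_nonneg_right (hmod x hx y hy hxy) hΦ₁
      have h2 := ht 0
      -- Cubic Taylor bound for sin at 3/5, half of the threshold length 6/5.
      have hu : Real.sin s ≤ 571 / 1000 := by
        have h3 : Real.sin s ≤ Real.sin (3 / 5) := Real.sin_le_sin_of_le_of_le_pi_div_two
          (by linarith [hsm.1, Real.pi_pos]) (by linarith [Real.pi_gt_three]) h35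
        have h4 := abs_le.1 (Real.sin_bound (x := 3 / 5) (by norm_num [abs_le]))
        norm_num [abs_of_pos] at h4
        linarith
      have := profile_inequality hδ0 hδ1 (hsin s hsm) (Real.sin_le_one s) hc.le hsc le_rfl
        (Or.inl hu)
      rw [add_zero] at h2
      rw [← hsdef] at h1
      change _ - _ * (Real.cos s * g') + _ ≤ _
      change _ - 3 * Real.sin s * g' - 0 * (Real.cos s * g') + _ ≤ _ at this
      change _ - Real.sin s * g' - _ + _ ≤ _
      linarith
    · have h1 := mul_le_mul_of_nonneg_right (hmod' x hx y hy (by rw [hsdef] at h35; linarith)) hΦ₁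
      have := profile_inequality hδ0 hδ1 (hsin s hsm) (Real.sin_le_one s) hc.le hsc hδ0.le
        (Or.inr le_rfl)
      have h2 := ht δ
      rw [← hsdef] at h1
      change _ - _ * (Real.cos s * g') + _ ≤ _
      change _ - 3 * Real.sin s * g' - δ * (Real.cos s * g') + _ ≤ _ at this
      change _ - Real.sin s * g' - _ + _ ≤ _
      linarith

/-! ### From almost every point to every point -/

theorem exists_mem_Ioo_of_ae_restrict {s : Set ℝ} {P : ℝ → Prop}
    (h : ∀ᵐ x ∂volume.restrict s, P x) {u v : ℝ} (huv : u < v) (hs : Ioo u v ⊆ s) :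
    ∃ x ∈ Ioo u v, P x := by
  by_contra! hc
  have h1 : ∀ᵐ x ∂volume.restrict (Ioo u v), False := by
    filter_upwards [ae_restrict_of_ae_restrict_of_subset hs h, ae_restrict_mem measurableSet_Ioo]
      with x hx hxm
    exact hc x hxm hx
  rw [ae_iff] at h1
  simp [huv.not_ge] at h1

/-- Concave functions are locally Lipschitz on open intervals, hence differentiable almost
everywhere by Rademacher's theorem, applied locally. -/
theorem ae_differentiableAt_of_concaveOn {l : ℝ → ℝ} {u v : ℝ} (hl : ConcaveOn ℝ (Ioo u v) l) :
    ∀ᵐ x ∂volume.restrict (Ioo u v), DifferentiableAt ℝ l x := by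
  rw [ae_restrict_iff' measurableSet_Ioo]
  refine measure_null_of_locally_null _ fun x hx => ?_
  simp only [mem_compl_iff, mem_ofPred_eq, Classical.not_imp] at hx
  obtain ⟨K, t, ht, hK⟩ := hl.locallyLipschitzOn isOpen_Ioo hx.1
  rw [isOpen_Ioo.nhdsWithin_eq hx.1] at ht
  obtain ⟨t', ht't, ht'o, hxt'⟩ := mem_nhds_iff.1 ht
  refine ⟨_ ∩ t', inter_mem_nhdsWithin _ (ht'o.mem_nhds hxt'), ?_⟩
  refine measure_mono_null ?_ (hK.mono ht't).ae_differentiableWithinAt_of_mem_real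
  rintro y ⟨hy, hyt⟩ hy'
  simp only [mem_compl_iff, mem_ofPred_eq, Classical.not_imp] at hy
  exact hy.2 ((hy' hyt).differentiableAt (ht'o.mem_nhds hyt))

/-- A lower bound on increments of a monotone function between generic points holds between all
points. -/
theorem two_tan_add_le_of_ae {p : ℝ → ℝ} {d c r : ℝ} (hd : d ≤ Real.pi)
    (hp : MonotoneOn p (centred d)) {P : ℝ → Prop} (hP : ∀ᵐ x ∂volume.restrict (centred d), P x)
    (h : ∀ x ∈ centred d, ∀ y ∈ centred d, P x → P y → r < y - x → x < y →
      2 * Real.tan ((y - x) / 2) + c ≤ p y - p x) :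
    ∀ x ∈ centred d, ∀ y ∈ centred d, r < y - x → x < y →
      2 * Real.tan ((y - x) / 2) + c ≤ p y - p x := by
  intro x hx y hy hr hxy
  have hs : ∀ z ∈ Icc x y, z ∈ centred d := fun z hz => ⟨hx.1.trans_le hz.1, hz.2.trans_lt hy.2⟩
  have hrange : ∀ s, 0 ≤ s → s ≤ (y - x) / 2 → s ∈ Ioo (-(Real.pi / 2)) (Real.pi / 2) :=
    fun s h0 h1 => ⟨by linarith [Real.pi_pos], by linarith [hx.1, hy.2]⟩
  have hcos := Real.cos_pos_of_mem_Ioo (hrange ((y - x) / 2) (by linarith) le_rfl)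
  have hlim : Tendsto (fun η => 2 * Real.tan ((y - x) / 2 - η) + c) (𝓝[>] 0)
      (𝓝 (2 * Real.tan ((y - x) / 2) + c)) := by
    have h1 : ContinuousAt (fun η : ℝ => (y - x) / 2 - η) 0 := by fun_prop
    have h2 : ContinuousAt Real.tan ((fun η : ℝ => (y - x) / 2 - η) 0) := by
      simpa using Real.continuousAt_tan.2 hcos.ne'
    have h3 := ((h2.comp h1).const_mul 2).add_const c |>.tendsto
    simp only [Function.comp_apply, sub_zero] at h3
    exact h3.mono_left nhdsWithin_le_nhds
  refine le_of_tendsto hlim ?_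
  -- Move both ends inward by less than η to generic points: monotonicity of p only helps, and the
  -- loss in tan vanishes as η → 0.
  have h0 : 0 < min ((y - x) / 2) ((y - x - r) / 2) := lt_min (by linarith) (by linarith)
  filter_upwards [Ioo_mem_nhdsGT h0] with η hη
  have hη1 := hη.2.trans_le (min_le_left _ _)
  have hη2 := hη.2.trans_le (min_le_right _ _)
  have hη0 := hη.1
  obtain ⟨x', hx', hPx⟩ := exists_mem_Ioo_of_ae_restrict hP (show x < x + η by linarith)
    fun z hz => hs z ⟨hz.1.le, by linarith [hz.2]⟩
  obtain ⟨y', hy', hPy⟩ := exists_mem_Ioo_of_ae_restrict hP (show y - η < y by linarith)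
    fun z hz => hs z ⟨by linarith [hz.1], hz.2.le⟩
  have hxI := hs x' ⟨hx'.1.le, by linarith [hx'.2]⟩
  have hyI := hs y' ⟨by linarith [hy'.1], hy'.2.le⟩
  have h1 := h x' hxI y' hyI hPx hPy (by linarith [hx'.2, hy'.1]) (by linarith [hx'.2, hy'.1])
  have h2 := hp hx hxI hx'.1.le
  have h3 := hp hyI hy hy'.2.le
  have h4 : Real.tan ((y - x) / 2 - η) ≤ Real.tan ((y' - x') / 2) := by
    refine Real.strictMonoOn_tan.monotoneOn (hrange _ (by linarith) (by linarith))
      (hrange _ (by linarith [hx'.2, hy'.1]) (by linarith [hx'.1, hy'.2])) ?_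
    linarith [hx'.2, hy'.1]
  linarith

theorem centred_subset {d e : ℝ} (h : d ≤ e) : centred d ⊆ centred e :=
  Ioo_subset_Ioo (by linarith) (by linarith)

theorem toReal_monotoneOn {ψ : ℝ → EReal} (hψ : Admissible ψ) {d : ℝ} (hd : d ≤ Real.pi)
    (hfin : ∀ x ∈ centred d, ψ x ≠ ⊥ ∧ ψ x ≠ ⊤) :
    MonotoneOn (fun x => (ψ x).toReal) (centred d) := fun x hx y hy hxy =>
  EReal.toReal_le_toReal (hψ.mono (centred_subset hd hx) (centred_subset hd hy) hxy) (hfin x hx).1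
    (hfin y hy).2

/-! ### The bound in terms of π - d -/

/-- Jordan's inequality at (π - d)/2 gives cos(d/2) ≥ (π - d)/π. -/
theorem gap_cube_le_gapEigenvalue {d : ℝ} {ψ : ℝ → EReal} (hd : 0 < d) (hdπ : d ≤ Real.pi)
    (hψ : Admissible ψ) (hdom : dom ψ = centred d) :
    ENNReal.ofReal (3 + 1 / Real.pi ^ 3 * (Real.pi - d) ^ 3) ≤ gapEigenvalue d ψ := by
  have hmem : ∀ x ∈ centred d, x ∈ dom ψ := fun x hx => hdom ▸ hx
  refine le_trans (ENNReal.ofReal_le_ofReal ?_) (ofReal_le_gapEigenvalue_of_tan_modulus hd hdπ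
    (toReal_monotoneOn hψ hdπ fun x hx => (hmem x hx).2)
    fun x hx y hy hxy => hψ.modulus x (hmem x hx) y (hmem y hy) hxy)
  have h1 := Real.mul_le_sin (x := (Real.pi - d) / 2) (by linarith) (by linarith)
  have h2 : Real.sin ((Real.pi - d) / 2) = Real.cos (d / 2) := by
    rw [← Real.sin_pi_div_two_sub]; congr 1; ring
  rw [h2] at h1
  have hπ := Real.pi_pos
  have h3 : 0 ≤ 2 / Real.pi * ((Real.pi - d) / 2) := by
    have : 0 ≤ Real.pi - d := by linarith
    positivity
  have h4 := pow_le_pow_left₀ h3 h1 3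
  have h5 : (2 / Real.pi * ((Real.pi - d) / 2)) ^ 3 = 1 / Real.pi ^ 3 * (Real.pi - d) ^ 3 := by
    field_simp
  linarith

/-! ### Concavity of log h and its strict form where h is affine -/

theorem concaveOn_log_of_rpow {s : Set ℝ} {h : ℝ → ℝ} {m : ℝ} (hm : 0 < m)
    (hpos : ∀ x ∈ s, 0 < h x) (hh : ConcaveOn ℝ s fun x => h x ^ (1 / m)) :
    ConcaveOn ℝ s fun x => Real.log (h x) := by
  have hlog : ∀ x ∈ s, Real.log (h x) = m * Real.log (h x ^ (1 / m)) := fun x hx => by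
    rw [Real.log_rpow (hpos x hx)]; field_simp
  refine ⟨hh.1, fun x hx y hy a b ha hb hab => ?_⟩
  have hxy := hh.1 hx hy ha hb hab
  have hkx := Real.rpow_pos_of_pos (hpos x hx) (1 / m)
  have hky := Real.rpow_pos_of_pos (hpos y hy) (1 / m)
  have h1 := hh.2 hx hy ha hb hab
  have h2 := strictConcaveOn_log_Ioi.concaveOn.2 hkx hky ha hb hab
  have h3 : 0 < a • h x ^ (1 / m) + b • h y ^ (1 / m) :=
    (convex_Ioi (0 : ℝ)) hkx hky ha hb hab
  have h4 := mul_le_mul_of_nonneg_left (h2.trans (Real.log_le_log h3 h1)) hm.le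
  simp only
  rw [hlog x hx, hlog y hy, hlog _ hxy]
  simp only [smul_eq_mul] at h4 ⊢
  linarith

theorem deriv_le_deriv_of_concaveOn {l : ℝ → ℝ} {s : Set ℝ} (hl : ConcaveOn ℝ s l) {x y : ℝ}
    (hx : x ∈ s) (hy : y ∈ s) (hxy : x ≤ y) (hdx : DifferentiableAt ℝ l x)
    (hdy : DifferentiableAt ℝ l y) : deriv l y ≤ deriv l x := by
  rcases hxy.eq_or_lt with rfl | h
  · exact le_rfl
  · exact (hl.deriv_le_slope hx hy h hdy).trans (hl.slope_le_deriv hx hy h hdx)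

/-- A nonconstant affine function whose power `1 / m` is concave has `1 ≤ m`. -/
theorem one_le_of_concaveOn_rpow_affine {a b m s t : ℝ} {h : ℝ → ℝ} (hm : 0 < m)
    (hab : a ≤ b) (hpos : ∀ x ∈ Icc a b, 0 < h x)
    (hh : ConcaveOn ℝ (Icc a b) fun x => h x ^ (1 / m)) (haff : ∀ x ∈ Icc a b, h x = s * x + t)
    (hne : h a ≠ h b) : 1 ≤ m := by
  by_contra! hm1
  have ha : a ∈ Icc a b := ⟨le_rfl, hab⟩
  have hb : b ∈ Icc a b := ⟨hab, le_rfl⟩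
  have h1 := hh.2 ha hb (show (0 : ℝ) ≤ 1 / 2 by norm_num) (show (0 : ℝ) ≤ 1 / 2 by norm_num)
    (by norm_num)
  have h2 := (strictConvexOn_rpow (one_lt_one_div hm hm1)).2 (hpos a ha).le (hpos b hb).le hne
    (show (0 : ℝ) < 1 / 2 by norm_num) (show (0 : ℝ) < 1 / 2 by norm_num) (by norm_num)
  simp only [smul_eq_mul] at h1 h2
  have h3 : h (1 / 2 * a + 1 / 2 * b) = 1 / 2 * h a + 1 / 2 * h b := by
    rw [haff _ ⟨by linarith, by linarith⟩, haff a ha, haff b hb]; ring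
  rw [h3] at h1
  exact absurd h2 h1.not_gt

/-- The slope of `log h` drops by a definite amount across a long interval, if `h` is log-concave
and affine on `[a, b]`. -/
theorem deriv_log_drop {d a b s t M : ℝ} {h : ℝ → ℝ} (hdπ : d ≤ Real.pi)
    (hpos : ∀ x ∈ centred d, 0 < h x) (hl : ConcaveOn ℝ (centred d) fun x => Real.log (h x))
    (hsub : centred (Real.pi / 4) ⊆ Icc a b) (hsub' : Icc a b ⊆ centred d)
    (haff : ∀ x ∈ Icc a b, h x = s * x + t) (hM : ∀ x ∈ Icc a b, h x ≤ M) {x y : ℝ}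
    (hx : x ∈ centred d) (hy : y ∈ centred d)
    (hdx : DifferentiableAt ℝ (fun x => Real.log (h x)) x)
    (hdy : DifferentiableAt ℝ (fun x => Real.log (h x)) y) (hxy : 119 / 100 < y - x) :
    9 / 1000 * (s / M) ^ 2 ≤
      deriv (fun x => Real.log (h x)) x - deriv (fun x => Real.log (h x)) y := by
  have hπ := Real.pi_gt_d4
  have hπ' := Real.pi_lt_d4
  have hin : ∀ z, -(39 / 100) ≤ z → z ≤ 39 / 100 → z ∈ centred (Real.pi / 4) := fun z h1 h2 =>
    ⟨by linarith, by linarith⟩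
  have hd : ∀ z, -(39 / 100) ≤ z → z ≤ 39 / 100 →
      HasDerivAt (fun x => Real.log (h x)) (s / h z) z := fun z h1 h2 => by
    have hz := hin z h1 h2
    have hz' := hsub hz
    have e : (fun x => s * x + t) =ᶠ[𝓝 z] h := by
      filter_upwards [Ioo_mem_nhds hz.1 hz.2] with w hw
      exact (haff w (hsub hw)).symm
    have h3 : HasDerivAt (fun x => s * x + t) s z := by
      simpa using ((hasDerivAt_id z).const_mul s).add_const t
    exact (h3.congr_of_eventuallyEq e.symm).log (hpos z (hsub' hz')).ne'
  set x₁ := max x (-(39 / 100)) with hx₁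
  set y₁ := min y (39 / 100) with hy₁
  have hx2 := hx.1
  have hy2 := hy.2
  have hx₁l : -(39 / 100) ≤ x₁ := le_max_right _ _
  have hx₁u : x₁ ≤ 381 / 1000 := max_le (by linarith) (by norm_num)
  have hy₁u : y₁ ≤ 39 / 100 := min_le_right _ _
  have hy₁l : -(381 / 1000) ≤ y₁ := le_min (by linarith) (by norm_num)
  -- Since π/2 < 1.571, an interval of length over 1.19 inside I_π meets [-0.39, 0.39] in length at
  -- least 0.009; and 0.39 < π/8.
  have hlen : 9 / 1000 ≤ y₁ - x₁ := by
    rcases max_cases x (-(39 / 100)) with h1 | h1 <;>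
    rcases min_cases y (39 / 100) with h2 | h2 <;> rw [hx₁, hy₁, h1.1, h2.1] <;> linarith
  have hdx₁ := hd x₁ hx₁l (by linarith)
  have hdy₁ := hd y₁ (by linarith) hy₁u
  have hmx := hsub (hin x₁ hx₁l (by linarith))
  have hmy := hsub (hin y₁ (by linarith) hy₁u)
  have h1 := deriv_le_deriv_of_concaveOn hl hx (hsub' hmx) (le_max_left _ _) hdx hdx₁.differentiableAt
  have h2 := deriv_le_deriv_of_concaveOn hl (hsub' hmy) hy (min_le_left _ _) hdy₁.differentiableAt hdy
  rw [hdx₁.deriv] at h1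
  rw [hdy₁.deriv] at h2
  have px := hpos _ (hsub' hmx)
  have py := hpos _ (hsub' hmy)
  -- On the affine stretch (log h)' = s / h, whose drop is explicit; outside it, concavity gives the
  -- right sign.
  have h3 : s / h x₁ - s / h y₁ = s ^ 2 * (y₁ - x₁) / (h x₁ * h y₁) := by
    have : h y₁ - h x₁ = s * (y₁ - x₁) := by rw [haff _ hmx, haff _ hmy]; ring
    rw [div_sub_div _ _ px.ne' py.ne']
    congr 1
    linear_combination s * this
  have h4 : s ^ 2 * (9 / 1000) / (M * M) ≤ s ^ 2 * (y₁ - x₁) / (h x₁ * h y₁) := by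
    have := hM _ hmx
    have := hM _ hmy
    gcongr
    linarith
  have h5 : 9 / 1000 * (s / M) ^ 2 = s ^ 2 * (9 / 1000) / (M * M) := by
    rw [div_pow, ← sq]; ring
  linarith

end SpectralGap

/-! ### The bound in terms of h(a) and h(b) -/

theorem affine_gap_le_gapEigenvalue {d m a b : ℝ} {ψ f : ℝ → EReal} {h : ℝ → ℝ}
    (hdπ : d ≤ Real.pi) (hm : 0 < m) (hψ : SpectralGap.Admissible ψ)
    (hf : SpectralGap.Admissible f) (hdom : SpectralGap.dom f = SpectralGap.centred d)
    (hpos : ∀ x ∈ SpectralGap.centred d, 0 < h x)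
    (hconc : ConcaveOn ℝ (SpectralGap.centred d) (fun x => h x ^ (1 / m)))
    (hsub : SpectralGap.centred (Real.pi / 4) ⊆ Set.Icc a b)
    (hsub' : Set.Icc a b ⊆ SpectralGap.centred d)
    (haff : ∃ s t : ℝ, ∀ x ∈ Set.Icc a b, h x = s * x + t)
    (hae : ∀ᵐ x ∂(MeasureTheory.volume.restrict (SpectralGap.centred d)),
        ψ x = f x + ((-deriv (fun y => Real.log (h y)) x / 2 : ℝ) : EReal)) :
    ENNReal.ofReal (3 + 8 * (1 / 10 ^ 6) / (m * Real.pi ^ 2) *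
        (1 - min (h a) (h b) / max (h a) (h b)) ^ 2) ≤ SpectralGap.gapEigenvalue d ψ := by
  open SpectralGap in
  obtain ⟨s, t, haff⟩ := haff
  have hπ := Real.pi_pos
  have h0 : (0 : ℝ) ∈ Icc a b := hsub ⟨by linarith, by linarith⟩
  have hd : 0 < d := by have := (hsub' h0).2; linarith
  have hab : a ≤ b := h0.1.trans h0.2
  have ha : a ∈ Icc a b := ⟨le_rfl, hab⟩
  have hb : b ∈ Icc a b := ⟨hab, le_rfl⟩
  have hl := concaveOn_log_of_rpow hm hpos hconc
  have hgen := hae.and (ae_differentiableAt_of_concaveOn hl)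
  have hfmem : ∀ x ∈ centred d, x ∈ dom f := fun x hx => hdom ▸ hx
  have hval : ∀ x ∈ centred d,
      ψ x = f x + ((-deriv (fun y => Real.log (h y)) x / 2 : ℝ) : EReal) →
      ψ x = (((f x).toReal + -deriv (fun y => Real.log (h y)) x / 2 : ℝ) : EReal) :=
    fun x hx hx' => by
      rw [hx', EReal.coe_add, EReal.coe_toReal (hfmem x hx).2.2 (hfmem x hx).2.1]
  -- The formula for ψ holds only almost everywhere; monotonicity places ψ x between finite values
  -- at generic points on either side.
  have hfin : ∀ x ∈ centred d, ψ x ≠ ⊥ ∧ ψ x ≠ ⊤ := fun x hx => by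
    obtain ⟨u, hu, hψu⟩ := exists_mem_Ioo_of_ae_restrict hae hx.1
      fun z hz => ⟨hz.1, hz.2.trans hx.2⟩
    obtain ⟨v, hv, hψv⟩ := exists_mem_Ioo_of_ae_restrict hae hx.2
      fun z hz => ⟨hx.1.trans hz.1, hz.2⟩
    have hu' : u ∈ centred d := ⟨hu.1, hu.2.trans hx.2⟩
    have hv' : v ∈ centred d := ⟨hx.1.trans hv.1, hv.2⟩
    have h1 := hψ.mono (centred_subset hdπ hu') (centred_subset hdπ hx) hu.2.le
    have h2 := hψ.mono (centred_subset hdπ hx) (centred_subset hdπ hv') hv.1.le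
    rw [hval u hu' hψu] at h1
    rw [hval v hv' hψv] at h2
    exact ⟨ne_bot_of_le_ne_bot (EReal.coe_ne_bot _) h1, ne_top_of_le_ne_top (EReal.coe_ne_top _) h2⟩
  have hp := toReal_monotoneOn hψ hdπ hfin
  have hdiff : ∀ x ∈ centred d, ∀ y ∈ centred d,
      ψ x = f x + ((-deriv (fun y => Real.log (h y)) x / 2 : ℝ) : EReal) →
      ψ y = f y + ((-deriv (fun y => Real.log (h y)) y / 2 : ℝ) : EReal) → x < y →
      2 * Real.tan ((y - x) / 2) + (deriv (fun y => Real.log (h y)) x -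
        deriv (fun y => Real.log (h y)) y) / 2 ≤ (ψ y).toReal - (ψ x).toReal :=
    fun x hx y hy hx' hy' hxy => by
      have := hf.modulus x (hfmem x hx) y (hfmem y hy) hxy
      rw [hval x hx hx', hval y hy hy', EReal.toReal_coe, EReal.toReal_coe]
      linarith
  have hmod : ∀ x ∈ centred d, ∀ y ∈ centred d, x < y →
      2 * Real.tan ((y - x) / 2) ≤ (ψ y).toReal - (ψ x).toReal := fun x hx y hy hxy => by
    have := two_tan_add_le_of_ae (c := 0) (r := 0) hdπ hp hgen
      (fun x hx y hy hPx hPy _ hxy => by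
        have h1 := hdiff x hx y hy hPx.1 hPy.1 hxy
        have h2 := deriv_le_deriv_of_concaveOn hl hx hy hxy.le hPx.2 hPy.2
        linarith) x hx y hy (by linarith) hxy
    linarith
  have hpa := hpos a (hsub' ha)
  have hpb := hpos b (hsub' hb)
  by_cases hne : h a = h b
  · refine le_trans (ENNReal.ofReal_le_ofReal ?_)
      (ofReal_le_gapEigenvalue_of_tan_modulus hd hdπ hp hmod)
    have : 0 ≤ Real.cos (d / 2) := Real.cos_nonneg_of_mem_Icc ⟨by linarith, by linarith⟩
    rw [hne, min_self, max_self, div_self hpb.ne', sub_self]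
    have := pow_nonneg this 3
    linarith
  -- With m ≥ 1 the factor 1/m may be replaced by 1.
  have hm1 := one_le_of_concaveOn_rpow_affine hm hab (fun x hx => hpos x (hsub' hx))
    (hconc.subset hsub' (convex_Icc a b)) haff hne
  set M := max (h a) (h b) with hM
  have hM0 : 0 < M := lt_max_of_lt_left hpa
  have hhM : ∀ x ∈ Icc a b, h x ≤ M := fun x hx => by
    rw [haff x hx, hM, haff a ha, haff b hb]
    rcases le_total 0 s with hs | hs
    · exact le_max_of_le_right (by nlinarith [hx.2])
    · exact le_max_of_le_left (by nlinarith [hx.1])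
  have hs0 : s ≠ 0 := fun hs => hne (by rw [haff a ha, haff b hb, hs]; ring)
  have hr : (1 - min (h a) (h b) / M) ^ 2 = (s / M) ^ 2 * (b - a) ^ 2 := by
    have h1 : 1 - min (h a) (h b) / M = |h b - h a| / M := by
      rw [abs_sub_comm, ← max_sub_min_eq_abs', ← hM]
      field_simp
    rw [h1, div_pow, sq_abs, haff a ha, haff b hb]; ring
  have hr1 : (1 - min (h a) (h b) / M) ^ 2 ≤ 1 := by
    have h1 : 0 ≤ min (h a) (h b) / M := div_nonneg (le_min hpa.le hpb.le) hM0.le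
    have h2 : min (h a) (h b) / M ≤ 1 := div_le_one_of_le₀ min_le_max hM0.le
    exact pow_le_one₀ (by linarith) (by linarith)
  have hba : b - a ≤ Real.pi := by
    have := (hsub' ha).1; have := (hsub' hb).2; linarith
  have hba' : 3 / 5 ≤ b - a := by
    have := Real.pi_gt_three
    have h1 := (hsub (show -(3 / 10 : ℝ) ∈ centred (Real.pi / 4) from
      ⟨by linarith, by linarith⟩)).1
    have h2 := (hsub (show (3 / 10 : ℝ) ∈ centred (Real.pi / 4) from
      ⟨by linarith, by linarith⟩)).2
    linarith
  have hsM : 0 < (s / M) ^ 2 := by positivity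
  have hδ1 : 9 / 2000 * (s / M) ^ 2 ≤ 1 := by
    rw [hr] at hr1
    have : (3 / 5) ^ 2 ≤ (b - a) ^ 2 := by gcongr
    nlinarith
  -- Here δ = 9/2000 (s/M)², half of the drop of (log h)' because g enters ψ as g/2. The gain δ/500
  -- = 9·10⁻⁶ (s/M)² exceeds the required amount, which is at most 8·10⁻⁶ (s/M)² by m ≥ 1 and b - a
  -- ≤ π.
  refine le_trans (ENNReal.ofReal_le_ofReal ?_)
    (ofReal_le_gapEigenvalue_of_improved_modulus hd hdπ (by positivity) hδ1 hp hmod ?_)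
  · rw [hr]
    have h1 : (b - a) ^ 2 ≤ Real.pi ^ 2 := by gcongr
    have h2 : 8 * (1 / 10 ^ 6) / (m * Real.pi ^ 2) * ((s / M) ^ 2 * (b - a) ^ 2) ≤
        8 * (1 / 10 ^ 6) / (1 * Real.pi ^ 2) * ((s / M) ^ 2 * Real.pi ^ 2) := by gcongr
    have h3 : 8 * (1 / 10 ^ 6) / (1 * Real.pi ^ 2) * ((s / M) ^ 2 * Real.pi ^ 2) =
        8 / 10 ^ 6 * (s / M) ^ 2 := by field_simp
    rw [h3] at h2
    linarith
  · intro x hx y hy hxy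
    refine two_tan_add_le_of_ae (r := 119 / 100) hdπ hp hgen
      (fun x hx y hy hPx hPy hlen hxy => ?_) x hx y hy (by linarith) (by linarith)
    have h1 := hdiff x hx y hy hPx.1 hPy.1 hxy
    have h2 := deriv_log_drop hdπ hpos hl hsub hsub' haff hhM hx hy hPx.2 hPy.2 hlen
    linarith

theorem theoremt :
    (∃ C : ℝ, 0 < C ∧ ∀ (d : ℝ) (ψ : ℝ → EReal), 0 < d → d ≤ Real.pi →
      SpectralGap.Admissible ψ → SpectralGap.dom ψ = SpectralGap.centred d →
      ENNReal.ofReal (3 + C * (Real.pi - d) ^ 3) ≤ SpectralGap.gapEigenvalue d ψ) ∧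
    (∃ K : ℝ, 0 < K ∧ ∀ (d m a b : ℝ) (ψ f : ℝ → EReal) (h : ℝ → ℝ), d ≤ Real.pi → 0 < m →
      SpectralGap.Admissible ψ →
      SpectralGap.Admissible f → SpectralGap.dom f = SpectralGap.centred d →
      (∀ x ∈ SpectralGap.centred d, 0 < h x) →
      ConcaveOn ℝ (SpectralGap.centred d) (fun x => h x ^ (1 / m)) →
      SpectralGap.centred (Real.pi / 4) ⊆ Set.Icc a b →
      Set.Icc a b ⊆ SpectralGap.centred d →
      (∃ s t : ℝ, ∀ x ∈ Set.Icc a b, h x = s * x + t) →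
      (∀ᵐ x ∂(MeasureTheory.volume.restrict (SpectralGap.centred d)),
        ψ x = f x + ((-deriv (fun y => Real.log (h y)) x / 2 : ℝ) : EReal)) →
      SpectralGap.gapEigenvalue d ψ ≤ 7 →
      ENNReal.ofReal (3 + 8 * K / (m * Real.pi ^ 2) *
        (1 - min (h a) (h b) / max (h a) (h b)) ^ 2) ≤ SpectralGap.gapEigenvalue d ψ) :=
  ⟨⟨1 / Real.pi ^ 3, by positivity, fun _ _ hd hdπ hψ hdom =>
      SpectralGap.gap_cube_le_gapEigenvalue hd hdπ hψ hdom⟩,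
    1 / 10 ^ 6, by positivity, fun _ _ _ _ _ _ _ hdπ hm hψ hf hdom hpos hconc hsub hsub' haff hae _ =>
      affine_gap_le_gapEigenvalue hdπ hm hψ hf hdom hpos hconc hsub hsub' haff hae⟩
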